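/- In the problem $1\,||\,\Sigma w_jU_j$ we are given $n$ jobs $J_1,\dots,J_n$; job $J_j$ has a processing time $p_j$, a due date $d_j$ and a weight $w_j$, which are arbitrary non-negative integers. A schedule is a bijection $\pi:\{J_1,\dots,J_n\}\to\{1,\dots,n\}$; job $J_j$ is tardy in $\pi$ if its completion time $\sum_{i:\pi(J_i)\le\pi(J_j)}p_i$ is greater than $d_j$. The task is to compute a schedule that minimizes the total weight of the tardy jobs. Let $\nu_w$ and $\nu_p$ denote the number of different weights and the number of different processing times of the instance, respectively. Theorem. The problem $1\,||\,\Sigma w_jU_j$ is solvable in polynomial time when $\nu_w$ is constant, and when $\nu_p$ is constant. More precisely: (1) There is an algorithm that computes an optimal schedule for every instance and performs $O(n^{\nu_w+1}\log n)$ operations (additions, subtractions, comparisons and memory accesses on a random access machine with integer cells); for every constant $k$, its running time in bit operations (logarithmic cost) on the instances with $\nu_w\le k$ is bounded by a polynomial in the length of the binary encoding of the instance. (2) There is an algorithm that computes an optimal schedule for every instance and performs $O(n^{\nu_p+1}\log n)$ such operations; for every constant $k$, its running time in bit operations (logarithmic cost) on the instances with $\nu_p\le k$ is bounded by a polynomial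 in the length of the binary encoding of the instance. Here the constants implied by $O(\cdot)$ are absolute, and for $n\le 1$, where the logarithm vanishes, the bounds are to be read as $O(1)$. -/

import Mathlib

namespace TardyJobs

/-! ### The scheduling problem -/

/-- An instance with `n` jobs `0, …, n - 1`: job `j` has processing time `p j`, due date `d j` and
weight `w j`, all of them non-negative integers of arbitrary size. -/
structure Instance (n : ℕ) where
  p : Fin n → ℕ
  d : Fin n → ℕ
  w : Fin n → ℕ

namespace Instance

variable {n : ℕ} (I : Instance n)

/-- Completion time of job `j` when job `i` is processed at position `π i`, without idle time. -/
def completionTime (π : Equiv.Perm (Fin n)) (j : Fin n) : ℕ :=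
  ∑ i with π i ≤ π j, I.p i

/-- Total weight of the tardy jobs, that is, of the jobs completed after their due date. -/
def tardyWeight (π : Equiv.Perm (Fin n)) : ℕ :=
  ∑ j with I.d j < I.completionTime π j, I.w j

/-- The schedule `π` minimizes the weighted number of tardy jobs. -/
def IsOptimal (π : Equiv.Perm (Fin n)) : Prop :=
  ∀ σ : Equiv.Perm (Fin n), I.tardyWeight π ≤ I.tardyWeight σ

/-- The number of different weights. -/
def numWeights : ℕ := (Finset.univ.image I.w).card

/-- The number of different processing times. -/
def numProcTimes : ℕ := (Finset.univ.image I.p).card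

end Instance

/-! ### Random access machines

A program works on finitely many registers (the ones that it mentions) and on an unbounded memory.
Registers and memory cells hold natural numbers of arbitrary size. The only arithmetic is addition
and (truncated) subtraction; there is indirect addressing, and branching is on comparisons. -/

/-- Expressions; `load a` is the contents of the memory cell whose address is the value of `a`. -/
inductive Expr where
  | const (c : ℕ)
  | reg (r : ℕ)
  | load (a : Expr)
  | add (a b : Expr)
  | sub (a b : Expr)

/-- Programs. -/
inductive Prog where
  /-- do nothing -/
  | skip
  /-- register `r` receives the value of `e` -/
  | set (r : ℕ) (e : Expr)
  /-- the memory cell with address `a` receives the value of `e` -/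
  | store (a e : Expr)
  /-- first `P`, then `Q` -/
  | seq (P Q : Prog)
  /-- if `a < b` then `P` else `Q` -/
  | cond (a b : Expr) (P Q : Prog)
  /-- while `a < b` do `P` -/
  | loop (a b : Expr) (P : Prog)

structure State where
  reg : ℕ → ℕ
  mem : ℕ → ℕ

def Expr.eval (s : State) : Expr → ℕ
  | .const c => c
  | .reg r => s.reg r
  | .load a => s.mem (a.eval s)
  | .add a b => a.eval s + b.eval s
  | .sub a b => a.eval s - b.eval s

/-- Cost of evaluating an expression, when each operation is charged `ℓ v`, where `v` is the value
that it yields. An address is itself the value of an expression, hence it is charged as well. -/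
def Expr.cost (ℓ : ℕ → ℕ) (s : State) : Expr → ℕ
  | .const c => ℓ c
  | .reg r => ℓ (s.reg r)
  | .load a => a.cost ℓ s + ℓ (s.mem (a.eval s))
  | .add a b => a.cost ℓ s + b.cost ℓ s + ℓ (a.eval s + b.eval s)
  | .sub a b => a.cost ℓ s + b.cost ℓ s + ℓ (a.eval s - b.eval s)

/-- `Runs ℓ P s t s'`: the program `P`, started in state `s`, halts in state `s'` after time `t`,
where operations are charged according to `ℓ`. -/
inductive Runs (ℓ : ℕ → ℕ) : Prog → State → ℕ → State → Prop where
  | skip (s : State) : Runs ℓ .skip s 1 s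
  | set (r : ℕ) (e : Expr) (s : State) :
      Runs ℓ (.set r e) s (e.cost ℓ s + 1) ⟨Function.update s.reg r (e.eval s), s.mem⟩
  | store (a e : Expr) (s : State) :
      Runs ℓ (.store a e) s (a.cost ℓ s + e.cost ℓ s + 1)
        ⟨s.reg, Function.update s.mem (a.eval s) (e.eval s)⟩
  | seq {P Q : Prog} {s s₁ s₂ : State} {t₁ t₂ : ℕ} :
      Runs ℓ P s t₁ s₁ → Runs ℓ Q s₁ t₂ s₂ → Runs ℓ (.seq P Q) s (t₁ + t₂) s₂
  | cond_true {a b : Expr} {P Q : Prog} {s s' : State} {t : ℕ} :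
      a.eval s < b.eval s → Runs ℓ P s t s' →
      Runs ℓ (.cond a b P Q) s (a.cost ℓ s + b.cost ℓ s + 1 + t) s'
  | cond_false {a b : Expr} {P Q : Prog} {s s' : State} {t : ℕ} :
      ¬ a.eval s < b.eval s → Runs ℓ Q s t s' →
      Runs ℓ (.cond a b P Q) s (a.cost ℓ s + b.cost ℓ s + 1 + t) s'
  | loop_done {a b : Expr} {P : Prog} {s : State} :
      ¬ a.eval s < b.eval s → Runs ℓ (.loop a b P) s (a.cost ℓ s + b.cost ℓ s + 1) s
  | loop_step {a b : Expr} {P : Prog} {s s₁ s₂ : State} {t₁ t₂ : ℕ} :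
      a.eval s < b.eval s → Runs ℓ P s t₁ s₁ → Runs ℓ (.loop a b P) s₁ t₂ s₂ →
      Runs ℓ (.loop a b P) s (a.cost ℓ s + b.cost ℓ s + 1 + t₁ + t₂) s₂

/-- Uniform cost: every operation takes one unit of time. -/
def unitCost : ℕ → ℕ := fun _ => 1

/-- Logarithmic cost: the time of an operation is, up to an added 1, the number of binary digits of
the value that it yields. Polynomial time in this measure is polynomial time on Turing machines. -/
def bitCost : ℕ → ℕ := fun v => Nat.size v + 1

/-! ### Solving the problem on a machine -/

namespace Instance

variable {n : ℕ} (I : Instance n)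

/-- The input: cell `0` holds `n`, and the cells `3 j + 1`, `3 j + 2`, `3 j + 3` hold `p j`, `d j`,
`w j`. All other cells and all registers are `0`. -/
def initialState : State where
  reg := fun _ => 0
  mem := fun a =>
    if a = 0 then n
    else if h : (a - 1) / 3 < n then
      if (a - 1) % 3 = 0 then I.p ⟨(a - 1) / 3, h⟩
      else if (a - 1) % 3 = 1 then I.d ⟨(a - 1) / 3, h⟩
      else I.w ⟨(a - 1) / 3, h⟩
    else 0

/-- The length of the input in binary. -/
def inputLength : ℕ :=
  bitCost n + ∑ j, (bitCost (I.p j) + bitCost (I.d j) + bitCost (I.w j))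

end Instance

/-- The final state holds the schedule `π`: for every position `i`, cell `i` holds the index of the
job that is processed at position `i`. -/
def State.Holds {n : ℕ} (s : State) (π : Equiv.Perm (Fin n)) : Prop :=
  ∀ i : Fin n, s.mem i = (π.symm i : ℕ)

/-- On every instance, `P` halts and outputs an optimal schedule. -/
def Prog.Solves (P : Prog) : Prop :=
  ∀ (n : ℕ) (I : Instance n), ∃ (t : ℕ) (s : State) (π : Equiv.Perm (Fin n)),
    Runs unitCost P I.initialState t s ∧ s.Holds π ∧ I.IsOptimal π

/-- On the instance `I`, the program `P` halts within time `b`. -/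
def Prog.HaltsWithin (ℓ : ℕ → ℕ) (P : Prog) {n : ℕ} (I : Instance n) (b : ℕ) : Prop :=
  ∃ (t : ℕ) (s : State), Runs ℓ P I.initialState t s ∧ t ≤ b

/-- `P` runs in `O(n ^ (ν + 1) * log n)` operations, with an absolute implied constant, where `ν` is
a parameter of the instance. For `n ≥ 2` the summand `1` is immaterial; for `n ≤ 1`, where the
logarithm vanishes, it makes the bound a constant. -/
def Prog.RunsInTime (P : Prog) (ν : ∀ {n : ℕ}, Instance n → ℕ) : Prop :=
  ∃ C : ℕ, ∀ (n : ℕ) (I : Instance n),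
    P.HaltsWithin unitCost I (C * (n ^ (ν I + 1) * Nat.log 2 n + 1))

/-- For each constant `k`, the bit complexity of `P` on the instances with `ν ≤ k` is bounded by a
polynomial in the length of the input. -/
def Prog.PolyTimeForConstant (P : Prog) (ν : ∀ {n : ℕ}, Instance n → ℕ) : Prop :=
  ∀ k : ℕ, ∃ q : Polynomial ℕ, ∀ (n : ℕ) (I : Instance n),
    ν I ≤ k → P.HaltsWithin bitCost I (q.eval I.inputLength)

end TardyJobs

namespace TardyJobs

/-! A set of jobs can be completed on time exactly when its jobs meet their due dates if they are
processed first, by non-decreasing due dates. It therefore suffices to find a feasible set of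
maximum weight; `isOptimal_of_feasible` turns it into an optimal schedule.

Such a set is found by a dynamic program with one row for each prefix of the sorted list and one
column for each vector that counts the chosen jobs in every class. The classes are the distinct
processing times or the distinct weights, `ν` in number. A job of class `c` has the key `(n + 1) ^
c`, so the base `n + 1` digits of a sum of keys are the counts (`sum_eq_of_sum_pow_eq`), and `(n +
1) ^ ν` columns suffice (`sum_pow_lt`). The column determines the total time in one case and the
total weight in the other, and only the other quantity is left to optimize. One rule serves both
cases: keep the set with the larger value of weight minus time. `table_sound` and `table_complete`
show that every entry is realized by a feasible set and dominates all feasible sets in its column.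

Each of the `(n + 1) * (n + 1) ^ ν` entries takes a constant number of operations. Sorting and key
assignment are quadratic, which is affordable because `ν ≥ 1` when `n > 0`. Since `ν ≤ n`, replacing
`n + 1` by `n` costs only an absolute factor (`succ_pow_le`). The logarithm is needed nowhere,
except that it is at least 1 for `n ≥ 2`.

Running times are counted by `WP` as program size times a number of iterations. The bit complexity
then needs no separate analysis of the program: numbers gain at most as many digits as there are
operations (`Runs.bitCost_of_unitCost`), so a polynomial number of operations on numbers of
polynomial length is polynomial in bits. -/

/-! ### Uniform cost: a calculus for running times up to a constant factor -/

/-- The number of nodes of an expression, which is its uniform cost. -/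
def Expr.size : Expr → ℕ
  | .const _ => 1
  | .reg _ => 1
  | .load a => a.size + 1
  | .add a b => a.size + b.size + 1
  | .sub a b => a.size + b.size + 1

theorem Expr.cost_unitCost (s : State) (e : Expr) : e.cost unitCost s = e.size := by
  induction e <;> simp_all [Expr.cost, Expr.size, unitCost]

/-- The size of a program; it bounds the uniform cost of a run in which no loop is entered. -/
def Prog.size : Prog → ℕ
  | .skip => 1
  | .set _ e => e.size + 1
  | .store a e => a.size + e.size + 1
  | .seq P Q => P.size + Q.size
  | .cond a b P Q => a.size + b.size + 1 + P.size + Q.size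
  | .loop a b P => a.size + b.size + 1 + P.size

/-- From `s`, the program `P` reaches a state with property `Q` in at most `P.size * c` operations. -/
def WP (P : Prog) (c : ℕ) (Q : State → Prop) (s : State) : Prop :=
  ∃ t s', Runs unitCost P s t s' ∧ t ≤ P.size * c ∧ Q s'

theorem WP.mono {P : Prog} {c c' : ℕ} {Q Q' : State → Prop} {s : State}
    (h : WP P c Q s) (hc : c ≤ c') (hQ : ∀ s', Q s' → Q' s') : WP P c' Q' s := by
  obtain ⟨t, s', hr, ht, hs⟩ := h
  exact ⟨t, s', hr, ht.trans (Nat.mul_le_mul_left _ hc), hQ _ hs⟩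

theorem WP.seq {P Q : Prog} {c : ℕ} {R : State → Prop} {s : State}
    (h : WP P c (fun s' => WP Q c R s') s) : WP (.seq P Q) c R s := by
  obtain ⟨t, s', hr, ht, t', s'', hr', ht', hR⟩ := h
  refine ⟨_, _, .seq hr hr', ?_, hR⟩
  rw [Prog.size, Nat.add_mul]
  exact Nat.add_le_add ht ht'

theorem WP.cond {a b : Expr} {P Q : Prog} {c : ℕ} {R : State → Prop} {s : State} (hc : 1 ≤ c)
    (h₁ : a.eval s < b.eval s → WP P c R s) (h₂ : ¬ a.eval s < b.eval s → WP Q c R s) :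
    WP (.cond a b P Q) c R s := by
  by_cases h : a.eval s < b.eval s
  · obtain ⟨t, s', hr, ht, hR⟩ := h₁ h
    refine ⟨_, _, .cond_true h hr, ?_, hR⟩
    simp only [Prog.size, Expr.cost_unitCost]
    nlinarith [Nat.zero_le (Q.size * c)]
  · obtain ⟨t, s', hr, ht, hR⟩ := h₂ h
    refine ⟨_, _, .cond_false h hr, ?_, hR⟩
    simp only [Prog.size, Expr.cost_unitCost]
    nlinarith [Nat.zero_le (P.size * c)]

/-- `Inv i` describes the state after `i` rounds and forces exactly `N` of them. The factor `N + 1`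
also pays for the last, failing test. Nested loops multiply their factors, while `Prog.size` absorbs
all constants. -/
theorem WP.loop {a b : Expr} {P : Prog} {c N : ℕ} {s : State} (Inv : ℕ → State → Prop)
    (hc : 1 ≤ c) (h₀ : Inv 0 s)
    (hstep : ∀ i < N, ∀ s, Inv i s → a.eval s < b.eval s ∧ WP P c (Inv (i + 1)) s)
    (hdone : ∀ s, Inv N s → ¬ a.eval s < b.eval s) :
    WP (.loop a b P) (c * (N + 1)) (Inv N) s := by
  have key : ∀ k i s, i + k = N → Inv i s → ∃ t s', Runs unitCost (.loop a b P) s t s' ∧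
      t ≤ (Prog.loop a b P).size * (c * (k + 1)) ∧ Inv N s' := by
    intro k
    induction k with
    | zero =>
      intro i s hi hs
      obtain rfl : i = N := by omega
      refine ⟨_, s, .loop_done (hdone s hs), ?_, hs⟩
      simp only [Prog.size, Expr.cost_unitCost]
      nlinarith [Nat.zero_le (P.size * c)]
    | succ k ih =>
      intro i s hi hs
      obtain ⟨hlt, t, s', hr, ht, hs'⟩ := hstep i (by omega) s hs
      obtain ⟨t', s'', hr', ht', hs''⟩ := ih (i + 1) s' (by omega) hs'
      refine ⟨_, s'', .loop_step hlt hr hr', ?_, hs''⟩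
      simp only [Prog.size, Expr.cost_unitCost] at ht' ⊢
      nlinarith
  exact key N 0 s (by omega) h₀

/-- The effect of a program without loops. -/
def Prog.exec : Prog → State → State
  | .skip, s => s
  | .set r e, s => ⟨Function.update s.reg r (e.eval s), s.mem⟩
  | .store a e, s => ⟨s.reg, Function.update s.mem (a.eval s) (e.eval s)⟩
  | .seq P Q, s => Q.exec (P.exec s)
  | .cond a b P Q, s => if a.eval s < b.eval s then P.exec s else Q.exec s
  | .loop _ _ _, s => s

def Prog.loopFree : Prog → Bool
  | .seq P Q => P.loopFree && Q.loopFree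
  | .cond _ _ P Q => P.loopFree && Q.loopFree
  | .loop _ _ _ => false
  | _ => true

/-- Without loops every instruction is executed at most once, and the final state can be computed.
Verifying a loop body thereby reduces to simplifying `Prog.exec`. -/
theorem WP.exec {P : Prog} (hP : P.loopFree = true) {c : ℕ} (hc : 1 ≤ c) {Q : State → Prop}
    {s : State} (h : Q (P.exec s)) : WP P c Q s := by
  induction P generalizing s Q with
  | skip => exact ⟨1, s, .skip s, by simpa [Prog.size] using hc, h⟩
  | set r e => exact ⟨_, _, .set r e s, by
      rw [Expr.cost_unitCost]; exact Nat.le_mul_of_pos_right _ hc, h⟩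
  | store a e => exact ⟨_, _, .store a e s, by
      rw [Expr.cost_unitCost, Expr.cost_unitCost]; exact Nat.le_mul_of_pos_right _ hc, h⟩
  | seq P₁ P₂ ih₁ ih₂ =>
    simp only [Prog.loopFree, Bool.and_eq_true] at hP
    exact .seq (ih₁ hP.1 (ih₂ hP.2 h))
  | cond a b P₁ P₂ ih₁ ih₂ =>
    simp only [Prog.loopFree, Bool.and_eq_true] at hP
    simp only [Prog.exec] at h
    refine .cond hc (fun hab => ih₁ hP.1 ?_) (fun hab => ih₂ hP.2 ?_)
    · rwa [if_pos hab] at h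
    · rwa [if_neg hab] at h
  | loop => simp [Prog.loopFree] at hP

/-! ### Logarithmic cost

An operation at most doubles the largest value, so that uniform time `t` bounds the number of
digits that are added to the numbers in the machine. -/

def Expr.ConstsLe (B : ℕ) : Expr → Prop
  | .const c => c ≤ B
  | .reg _ => True
  | .load a => a.ConstsLe B
  | .add a b => a.ConstsLe B ∧ b.ConstsLe B
  | .sub a b => a.ConstsLe B ∧ b.ConstsLe B

def Prog.ConstsLe (B : ℕ) : Prog → Prop
  | .skip => True
  | .set _ e => e.ConstsLe B
  | .store a e => a.ConstsLe B ∧ e.ConstsLe B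
  | .seq P Q => P.ConstsLe B ∧ Q.ConstsLe B
  | .cond a b P Q => a.ConstsLe B ∧ b.ConstsLe B ∧ P.ConstsLe B ∧ Q.ConstsLe B
  | .loop a b P => a.ConstsLe B ∧ b.ConstsLe B ∧ P.ConstsLe B

theorem Expr.ConstsLe.mono {B B' : ℕ} (h : B ≤ B') {e : Expr} (he : e.ConstsLe B) :
    e.ConstsLe B' := by
  induction e <;> simp_all [Expr.ConstsLe]; omega

theorem Prog.ConstsLe.mono {B B' : ℕ} (h : B ≤ B') {P : Prog} (hP : P.ConstsLe B) :
    P.ConstsLe B' := by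
  have := @Expr.ConstsLe.mono B B' h
  induction P <;> simp_all [Prog.ConstsLe]

theorem Expr.exists_constsLe (e : Expr) : ∃ B, e.ConstsLe B := by
  induction e with
  | const c => exact ⟨c, le_rfl⟩
  | reg => exact ⟨0, trivial⟩
  | load a ih => exact ih
  | add a b iha ihb =>
    obtain ⟨A, hA⟩ := iha
    obtain ⟨B, hB⟩ := ihb
    exact ⟨A + B, hA.mono (by omega), hB.mono (by omega)⟩
  | sub a b iha ihb =>
    obtain ⟨A, hA⟩ := iha
    obtain ⟨B, hB⟩ := ihb
    exact ⟨A + B, hA.mono (by omega), hB.mono (by omega)⟩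

theorem Prog.exists_constsLe (P : Prog) : ∃ B, P.ConstsLe B := by
  induction P with
  | skip => exact ⟨0, trivial⟩
  | set r e => exact e.exists_constsLe
  | store a e =>
    obtain ⟨A, hA⟩ := a.exists_constsLe
    obtain ⟨B, hB⟩ := e.exists_constsLe
    exact ⟨A + B, hA.mono (by omega), hB.mono (by omega)⟩
  | seq P Q ihP ihQ =>
    obtain ⟨A, hA⟩ := ihP
    obtain ⟨B, hB⟩ := ihQ
    exact ⟨A + B, hA.mono (by omega), hB.mono (by omega)⟩
  | cond a b P Q ihP ihQ =>
    obtain ⟨A, hA⟩ := ihP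
    obtain ⟨B, hB⟩ := ihQ
    obtain ⟨A', hA'⟩ := a.exists_constsLe
    obtain ⟨B', hB'⟩ := b.exists_constsLe
    exact ⟨A + B + A' + B', hA'.mono (by omega), hB'.mono (by omega), hA.mono (by omega),
      hB.mono (by omega)⟩
  | loop a b P ihP =>
    obtain ⟨A, hA⟩ := ihP
    obtain ⟨A', hA'⟩ := a.exists_constsLe
    obtain ⟨B', hB'⟩ := b.exists_constsLe
    exact ⟨A + A' + B', hA'.mono (by omega), hB'.mono (by omega), hA.mono (by omega)⟩

/-- All registers and memory cells hold numbers that are at most `B`. -/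
def State.BddBy (s : State) (B : ℕ) : Prop := (∀ r, s.reg r ≤ B) ∧ ∀ a, s.mem a ≤ B

theorem State.BddBy.mono {s : State} {B B' : ℕ} (hs : s.BddBy B) (h : B ≤ B') : s.BddBy B' :=
  ⟨fun r => (hs.1 r).trans h, fun a => (hs.2 a).trans h⟩

theorem two_pow_le_two_pow {a b : ℕ} (h : a ≤ b) : 2 ^ a ≤ 2 ^ b :=
  Nat.pow_le_pow_right (by norm_num) h

/-- Only addition enlarges a value, and it at most doubles the larger summand: one binary digit for
each node. -/
theorem Expr.eval_le {b : ℕ} {s : State} (hs : s.BddBy (2 ^ b)) {e : Expr}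
    (he : e.ConstsLe (2 ^ b)) : e.eval s ≤ 2 ^ (b + e.size) := by
  induction e with
  | const c => exact (show c ≤ _ from he).trans (two_pow_le_two_pow (by omega))
  | reg r => exact (hs.1 r).trans (two_pow_le_two_pow (by omega))
  | load a ih => exact (hs.2 _).trans (two_pow_le_two_pow (by omega))
  | add x y ihx ihy =>
    have hx := (ihx he.1).trans (two_pow_le_two_pow (show _ ≤ b + x.size + y.size by omega))
    have hy := (ihy he.2).trans (two_pow_le_two_pow (show _ ≤ b + x.size + y.size by omega))
    have : 2 ^ (b + (Expr.add x y).size) = 2 ^ (b + x.size + y.size) * 2 := by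
      rw [← pow_succ]
      congr 1
      simp only [Expr.size]
      omega
    simp only [Expr.eval]
    omega
  | sub x y ihx ihy =>
    refine (Nat.sub_le _ _).trans ((ihx he.1).trans (two_pow_le_two_pow ?_))
    simp only [Expr.size]
    omega

theorem bitCost_le {v b : ℕ} (h : v ≤ 2 ^ b) : bitCost v ≤ b + 2 := by
  have : Nat.size v ≤ b + 1 :=
    Nat.size_le.2 (h.trans_lt (Nat.pow_lt_pow_right (by norm_num) (by omega)))
  unfold bitCost
  omega

theorem Expr.cost_bitCost_le {b : ℕ} {s : State} (hs : s.BddBy (2 ^ b)) {e : Expr}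
    (he : e.ConstsLe (2 ^ b)) {m : ℕ} (hm : b + e.size + 2 ≤ m) :
    e.cost bitCost s ≤ e.size * m := by
  have hv := (bitCost_le (Expr.eval_le hs he)).trans hm
  induction e with
  | const c => simpa [Expr.cost, Expr.size, Expr.eval] using hv
  | reg r => simpa [Expr.cost, Expr.size, Expr.eval] using hv
  | load a ih =>
    simp only [Expr.size, Expr.eval, Expr.cost] at *
    have := ih he (by omega) ((bitCost_le (Expr.eval_le (e := a) hs he)).trans (by omega))
    rw [Nat.add_mul]
    omega
  | add x y ihx ihy =>
    simp only [Expr.size, Expr.eval, Expr.cost] at *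
    have h₁ := ihx he.1 (by omega) ((bitCost_le (Expr.eval_le hs he.1)).trans (by omega))
    have h₂ := ihy he.2 (by omega) ((bitCost_le (Expr.eval_le hs he.2)).trans (by omega))
    rw [Nat.add_mul, Nat.add_mul]
    omega
  | sub x y ihx ihy =>
    simp only [Expr.size, Expr.eval, Expr.cost] at *
    have h₁ := ihx he.1 (by omega) ((bitCost_le (Expr.eval_le hs he.1)).trans (by omega))
    have h₂ := ihy he.2 (by omega) ((bitCost_le (Expr.eval_le hs he.2)).trans (by omega))
    rw [Nat.add_mul, Nat.add_mul]
    omega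

theorem update_le {f : ℕ → ℕ} {B a v : ℕ} (hf : ∀ x, f x ≤ B) (hv : v ≤ B) (x : ℕ) :
    Function.update f a v x ≤ B := by
  rw [Function.update_apply]
  split_ifs
  exacts [hv, hf x]

/-- A run of `t` operations costs at most `t * (b + t + 2)` in bit operations, if the numbers at
the start are at most `2 ^ b`. -/
theorem Runs.bitCost_of_unitCost {P : Prog} {s s' : State} {t : ℕ}
    (h : Runs unitCost P s t s') :
    ∀ b, s.BddBy (2 ^ b) → P.ConstsLe (2 ^ b) →
      s'.BddBy (2 ^ (b + t)) ∧ ∃ t', Runs bitCost P s t' s' ∧ t' ≤ t * (b + t + 2) := by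
  induction h with
  | skip s =>
    intro b hs _
    exact ⟨hs.mono (two_pow_le_two_pow (by omega)), 1, .skip s, by omega⟩
  | set r e s =>
    intro b hs he
    rw [Expr.cost_unitCost]
    have hs' := hs.mono (two_pow_le_two_pow (show b ≤ b + (e.size + 1) by omega))
    refine ⟨⟨update_le hs'.1 ?_, hs'.2⟩, _, .set r e s, ?_⟩
    · exact (Expr.eval_le hs he).trans (two_pow_le_two_pow (by omega))
    · have := Expr.cost_bitCost_le hs he (m := b + (e.size + 1) + 2) (by omega)
      rw [Nat.add_mul]
      omega
  | store a e s =>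
    intro b hs he
    rw [Expr.cost_unitCost, Expr.cost_unitCost]
    have hs' := hs.mono (two_pow_le_two_pow (show b ≤ b + (a.size + e.size + 1) by omega))
    refine ⟨⟨hs'.1, update_le hs'.2 ?_⟩, _, .store a e s, ?_⟩
    · exact (Expr.eval_le hs he.2).trans (two_pow_le_two_pow (by omega))
    · have h₁ := Expr.cost_bitCost_le hs he.1 (m := b + (a.size + e.size + 1) + 2) (by omega)
      have h₂ := Expr.cost_bitCost_le hs he.2 (m := b + (a.size + e.size + 1) + 2) (by omega)
      rw [Nat.add_mul, Nat.add_mul]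
      omega
  | @seq P Q s s₁ s₂ t₁ t₂ _ _ ih₁ ih₂ =>
    intro b hs hP
    obtain ⟨hs₁, u₁, hr₁, hu₁⟩ := ih₁ b hs hP.1
    obtain ⟨hs₂, u₂, hr₂, hu₂⟩ := ih₂ (b + t₁) hs₁ (hP.2.mono (two_pow_le_two_pow (by omega)))
    refine ⟨by rwa [← Nat.add_assoc], _, .seq hr₁ hr₂, ?_⟩
    nlinarith [Nat.zero_le (t₁ * t₂)]
  | @cond_true x y P Q s s' t hxy _ ih =>
    intro b hs hP
    obtain ⟨hs', u, hr, hu⟩ := ih b hs hP.2.2.1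
    rw [Expr.cost_unitCost, Expr.cost_unitCost]
    set m := b + (x.size + y.size + 1 + t) + 2 with hm
    refine ⟨hs'.mono (two_pow_le_two_pow (by omega)), _, .cond_true hxy hr, ?_⟩
    have h₁ := Expr.cost_bitCost_le hs hP.1 (m := m) (by omega)
    have h₂ := Expr.cost_bitCost_le hs hP.2.1 (m := m) (by omega)
    have h₃ : t * (b + t + 2) ≤ t * m := Nat.mul_le_mul_left _ (by omega)
    rw [Nat.add_mul, Nat.add_mul, Nat.add_mul]
    omega
  | @cond_false x y P Q s s' t hxy _ ih =>
    intro b hs hP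
    obtain ⟨hs', u, hr, hu⟩ := ih b hs hP.2.2.2
    rw [Expr.cost_unitCost, Expr.cost_unitCost]
    set m := b + (x.size + y.size + 1 + t) + 2 with hm
    refine ⟨hs'.mono (two_pow_le_two_pow (by omega)), _, .cond_false hxy hr, ?_⟩
    have h₁ := Expr.cost_bitCost_le hs hP.1 (m := m) (by omega)
    have h₂ := Expr.cost_bitCost_le hs hP.2.1 (m := m) (by omega)
    have h₃ : t * (b + t + 2) ≤ t * m := Nat.mul_le_mul_left _ (by omega)
    rw [Nat.add_mul, Nat.add_mul, Nat.add_mul]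
    omega
  | @loop_done x y P s hxy =>
    intro b hs hP
    rw [Expr.cost_unitCost, Expr.cost_unitCost]
    set m := b + (x.size + y.size + 1) + 2 with hm
    refine ⟨hs.mono (two_pow_le_two_pow (by omega)), _, .loop_done hxy, ?_⟩
    have h₁ := Expr.cost_bitCost_le hs hP.1 (m := m) (by omega)
    have h₂ := Expr.cost_bitCost_le hs hP.2.1 (m := m) (by omega)
    rw [Nat.add_mul, Nat.add_mul]
    omega
  | @loop_step x y P s s₁ s₂ t₁ t₂ hxy _ _ ih₁ ih₂ =>
    intro b hs hP
    obtain ⟨hs₁, u₁, hr₁, hu₁⟩ := ih₁ b hs hP.2.2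
    obtain ⟨hs₂, u₂, hr₂, hu₂⟩ := ih₂ (b + t₁) hs₁ (hP.mono (two_pow_le_two_pow (by omega)))
    rw [Expr.cost_unitCost, Expr.cost_unitCost]
    set m := b + (x.size + y.size + 1 + t₁ + t₂) + 2 with hm
    refine ⟨hs₂.mono (two_pow_le_two_pow (by omega)), _, .loop_step hxy hr₁ hr₂, ?_⟩
    have h₁ := Expr.cost_bitCost_le hs hP.1 (m := m) (by omega)
    have h₂ := Expr.cost_bitCost_le hs hP.2.1 (m := m) (by omega)
    have h₃ : t₁ * (b + t₁ + 2) ≤ t₁ * m := Nat.mul_le_mul_left _ (by omega)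
    have h₄ : t₂ * (b + t₁ + t₂ + 2) ≤ t₂ * m := Nat.mul_le_mul_left _ (by omega)
    rw [Nat.add_mul, Nat.add_mul, Nat.add_mul, Nat.add_mul]
    omega

/-! ### From a bound on the operations to a polynomial in the input length -/

theorem Instance.le_inputLength {n : ℕ} (I : Instance n) : n ≤ I.inputLength := by
  have h : ∑ _j : Fin n, 1 ≤ ∑ j, (bitCost (I.p j) + bitCost (I.d j) + bitCost (I.w j)) :=
    Finset.sum_le_sum fun j _ => by
      unfold bitCost
      omega
  simp only [Finset.sum_const, Finset.card_univ, Fintype.card_fin, smul_eq_mul, mul_one] at h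
  unfold Instance.inputLength
  omega

theorem le_two_pow_of_bitCost_le {v L : ℕ} (h : bitCost v ≤ L) : v ≤ 2 ^ L :=
  (Nat.lt_size_self v).le.trans (two_pow_le_two_pow (by unfold bitCost at h; omega))

theorem Instance.initialState_bddBy {n : ℕ} (I : Instance n) :
    I.initialState.BddBy (2 ^ I.inputLength) := by
  refine ⟨fun r => Nat.zero_le _, fun a => ?_⟩
  have hj (j : Fin n) : bitCost (I.p j) + bitCost (I.d j) + bitCost (I.w j) ≤ I.inputLength :=
    (Finset.single_le_sum (f := fun j => bitCost (I.p j) + bitCost (I.d j) + bitCost (I.w j))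
      (fun _ _ => Nat.zero_le _) (Finset.mem_univ j)).trans (Nat.le_add_left _ _)
  simp only [Instance.initialState]
  split_ifs with h₀ h₁ h₂ h₃
  · exact le_two_pow_of_bitCost_le (Nat.le_add_right _ _)
  · exact le_two_pow_of_bitCost_le (by have := hj ⟨_, h₁⟩; omega)
  · exact le_two_pow_of_bitCost_le (by have := hj ⟨_, h₁⟩; omega)
  · exact le_two_pow_of_bitCost_le (by have := hj ⟨_, h₁⟩; omega)
  · exact Nat.zero_le _

theorem Prog.RunsInTime.polyTimeForConstant {P : Prog} {ν : ∀ {n : ℕ}, Instance n → ℕ}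
    (h : P.RunsInTime ν) : P.PolyTimeForConstant ν := by
  obtain ⟨C, hC⟩ := h
  obtain ⟨B, hB⟩ := P.exists_constsLe
  intro k
  -- The first factor bounds the number of operations, with the logarithm replaced by `X`. The
  -- second is `b + t + 2` from `Runs.bitCost_of_unitCost` with `b = L + B`, where `B` accounts for
  -- the constants in the program.
  refine ⟨(Polynomial.C C * (Polynomial.X ^ (k + 1) * Polynomial.X + 1)) *
    (Polynomial.X + Polynomial.C B + (Polynomial.C C * (Polynomial.X ^ (k + 1) * Polynomial.X + 1))
      + 2), fun n I hI => ?_⟩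
  obtain ⟨t, s, hr, ht⟩ := hC n I
  set L := I.inputLength with hL
  have hb : B ≤ 2 ^ (L + B) :=
    Nat.lt_two_pow_self.le.trans (two_pow_le_two_pow (by omega))
  obtain ⟨-, t', hr', ht'⟩ := hr.bitCost_of_unitCost (L + B)
    (I.initialState_bddBy.mono (two_pow_le_two_pow (by omega))) (hB.mono hb)
  refine ⟨t', s, hr', ht'.trans ?_⟩
  have hL1 : 1 ≤ L := by
    simp only [hL, Instance.inputLength, bitCost]
    omega
  have hn : n ≤ L := I.le_inputLength
  have h1 : n ^ (ν I + 1) ≤ L ^ (k + 1) :=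
    (Nat.pow_le_pow_left hn _).trans (Nat.pow_le_pow_right hL1 (Nat.add_le_add_right hI 1))
  have h2 : Nat.log 2 n ≤ L := (Nat.log_le_self 2 n).trans hn
  have h3 : t ≤ C * (L ^ (k + 1) * L + 1) :=
    ht.trans (Nat.mul_le_mul_left _ (Nat.add_le_add_right (Nat.mul_le_mul h1 h2) 1))
  have : Polynomial.eval L (2 : Polynomial ℕ) = 2 := by
    simp
  simp only [Polynomial.eval_mul, Polynomial.eval_add, Polynomial.eval_C, Polynomial.eval_pow,
    Polynomial.eval_X, Polynomial.eval_one, this]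
  exact Nat.mul_le_mul h3 (by omega)

open Finset

/-! ### The dynamic program

Jobs `0, 1, 2, …` are listed by non-decreasing due dates. -/

/-- The jobs of `S` all meet their due dates when they are processed first, in their order. -/
def Feasible (p d : ℕ → ℕ) (S : Finset ℕ) : Prop :=
  ∀ j ∈ S, ∑ i ∈ S with i ≤ j, p i ≤ d j

/-- Job `r` is processed after all jobs of `S` and does not delay them, so its own due date is the
only new condition. -/
theorem feasible_insert {p d : ℕ → ℕ} {r : ℕ} {S : Finset ℕ} (hS : S ⊆ range r) :
    Feasible p d (insert r S) ↔ Feasible p d S ∧ ∑ i ∈ S, p i + p r ≤ d r := by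
  have hr : r ∉ S := fun h => by simpa using hS h
  have hlt : ∀ i ∈ S, i < r := fun i hi => mem_range.1 (hS hi)
  have hfr : ∑ i ∈ insert r S with i ≤ r, p i = ∑ i ∈ S, p i + p r := by
    rw [filter_true_of_mem, sum_insert hr, Nat.add_comm]
    intro i hi
    rcases mem_insert.1 hi with rfl | hi
    exacts [le_rfl, (hlt i hi).le]
  have hfj : ∀ j ∈ S, ∑ i ∈ insert r S with i ≤ j, p i = ∑ i ∈ S with i ≤ j, p i := by
    intro j hj
    rw [filter_insert, if_neg (not_le.2 (hlt j hj))]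
  unfold Feasible
  constructor
  · intro h
    exact ⟨fun j hj => hfj j hj ▸ h j (mem_insert_of_mem hj), hfr ▸ h r (mem_insert_self _ _)⟩
  · rintro ⟨h, hr'⟩ j hj
    rcases mem_insert.1 hj with rfl | hj
    · rwa [hfr]
    · rw [hfj j hj]
      exact h j hj

/-- An entry of the table: `tag` is `0` if no set of jobs is recorded, `1` if the recorded set does
not contain the last job considered, and `2` if it does; `time` and `weight` are the total
processing time and the total weight of the recorded set. -/
structure Entry where
  tag : ℕ
  time : ℕ
  weight : ℕ

/-- The entry that results from the entry `o` and from adding a job to the entry `c`. -/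
def Entry.step (p d w : ℕ) (o c : Entry) : Entry :=
  if 0 < c.tag ∧ c.time + p ≤ d ∧
      (o.tag = 0 ∨ c.time + p + o.weight < o.time + (c.weight + w)) then
    ⟨2, c.time + p, c.weight + w⟩
  else if 0 < o.tag then ⟨1, o.time, o.weight⟩ else ⟨0, 0, 0⟩

/-- The table of the dynamic program, for sets of jobs among the first `r` whose keys sum to `x`. -/
def table (p d w κ : ℕ → ℕ) : ℕ → ℕ → Entry
  | 0, x => if x = 0 then ⟨1, 0, 0⟩ else ⟨0, 0, 0⟩
  | r + 1, x => Entry.step (p r) (d r) (w r) (table p d w κ r x)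
      (if κ r ≤ x then table p d w κ r (x - κ r) else ⟨0, 0, 0⟩)

/-- The set of jobs that is recorded in an entry of the table. -/
def trace (p d w κ : ℕ → ℕ) : ℕ → ℕ → Finset ℕ
  | 0, _ => ∅
  | r + 1, x => if 1 < (table p d w κ (r + 1) x).tag then
      insert r (trace p d w κ r (x - κ r)) else trace p d w κ r x

section DynamicProgram

variable {p d w κ : ℕ → ℕ}

theorem trace_subset (r x : ℕ) : trace p d w κ r x ⊆ range r := by
  induction r generalizing x with
  | zero => simp [trace]
  | succ r ih =>
    have hr : range r ⊆ range (r + 1) := range_subset_range.2 (Nat.le_succ r)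
    rw [trace]
    split_ifs
    · exact insert_subset (by simp) ((ih _).trans hr)
    · exact (ih _).trans hr

/-- This allows the search for the best entry to compare weights without inspecting tags. -/
theorem table_weight_eq_zero {r x : ℕ} (h : (table p d w κ r x).tag = 0) :
    (table p d w κ r x).weight = 0 := by
  cases r with
  | zero =>
    unfold table at h ⊢
    split_ifs <;> rfl
  | succ r =>
    unfold table Entry.step at h ⊢
    split_ifs at h ⊢ <;> simp_all

/-- `trace` repeats the choices of `Entry.step`. The default candidate has tag `0` and is never
taken, so `x - κ r` is a genuine difference whenever job `r` is added. -/
theorem table_sound {r x : ℕ} (h : 0 < (table p d w κ r x).tag) :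
    Feasible p d (trace p d w κ r x) ∧ ∑ i ∈ trace p d w κ r x, κ i = x ∧
      ∑ i ∈ trace p d w κ r x, p i = (table p d w κ r x).time ∧
      ∑ i ∈ trace p d w κ r x, w i = (table p d w κ r x).weight := by
  induction r generalizing x with
  | zero =>
    simp only [table] at h ⊢
    split_ifs at h ⊢ with hx
    · simp [trace, hx, Feasible]
    · simp at h
  | succ r ih =>
    have hmem (y : ℕ) : r ∉ trace p d w κ r y := fun hr => by simpa using trace_subset _ _ hr
    rw [trace]
    rw [table] at h ⊢
    set c := if κ r ≤ x then table p d w κ r (x - κ r) else ⟨0, 0, 0⟩ with hc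
    have hc' : 0 < c.tag → κ r ≤ x ∧ c = table p d w κ r (x - κ r) := by
      rw [hc]
      split_ifs with hx
      · exact fun _ => ⟨hx, rfl⟩
      · simp
    clear_value c
    rw [Entry.step] at h ⊢
    split_ifs at h ⊢ with h₁ h₂ <;> try (simp at h₂; done)
    · obtain ⟨hx, rfl⟩ := hc' h₁.1
      obtain ⟨hf, hk, hp, hw⟩ := ih h₁.1
      rw [feasible_insert (trace_subset _ _), sum_insert (hmem _), sum_insert (hmem _),
        sum_insert (hmem _), hk, hp, hw]
      exact ⟨⟨hf, h₁.2.1⟩, by omega, Nat.add_comm _ _, Nat.add_comm _ _⟩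
    all_goals first | exact ih ‹_› | simp_all

/-- An entry has to dominate every feasible `S` of its column in time and weight at once. By
induction one of the two options for the entry does, and the step keeps the option with the larger
weight minus time. As `hκ` makes the kept set agree with `S` in one of the two quantities, the
larger difference yields dominance in the other. -/
theorem table_complete {n : ℕ}
    (hκ : (∀ S ⊆ range n, ∀ T ⊆ range n, ∑ i ∈ S, κ i = ∑ i ∈ T, κ i →
        ∑ i ∈ S, p i = ∑ i ∈ T, p i) ∨
      (∀ S ⊆ range n, ∀ T ⊆ range n, ∑ i ∈ S, κ i = ∑ i ∈ T, κ i →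
        ∑ i ∈ S, w i = ∑ i ∈ T, w i)) {r : ℕ} (hr : r ≤ n) {S : Finset ℕ} (hS : S ⊆ range r)
    (hf : Feasible p d S) :
    0 < (table p d w κ r (∑ i ∈ S, κ i)).tag ∧
      (table p d w κ r (∑ i ∈ S, κ i)).time ≤ ∑ i ∈ S, p i ∧
      ∑ i ∈ S, w i ≤ (table p d w κ r (∑ i ∈ S, κ i)).weight := by
  induction r generalizing S with
  | zero =>
    obtain rfl : S = ∅ := by simpa using hS
    simp [table]
  | succ r ih =>
    set x := ∑ i ∈ S, κ i with hx
    set e := table p d w κ (r + 1) x with he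
    set o := table p d w κ r x with ho
    -- the recorded set is comparable with every recorded set and with `S`
    have hcmp : 0 < e.tag → ∀ T ⊆ range (r + 1), ∑ i ∈ T, κ i = x →
        ∑ i ∈ T, p i = e.time ∨ ∑ i ∈ T, w i = e.weight := by
      intro he' T hT hTx
      obtain ⟨-, h₂, h₃, h₄⟩ := table_sound he'
      have hsub := (range_subset_range.2 hr)
      rcases hκ with hκ | hκ
      · exact .inl ((hκ _ (hT.trans hsub) _ ((trace_subset _ _).trans hsub)
          (hTx.trans h₂.symm)).trans h₃)
      · exact .inr ((hκ _ (hT.trans hsub) _ ((trace_subset _ _).trans hsub)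
          (hTx.trans h₂.symm)).trans h₄)
    by_cases hrS : r ∈ S
    · have hT : S.erase r ⊆ range r := by
        intro i hi
        have := mem_range.1 (hS (mem_of_mem_erase hi))
        have := ne_of_mem_erase hi
        exact mem_range.2 (by omega)
      have hsum (f : ℕ → ℕ) : ∑ i ∈ S, f i = ∑ i ∈ S.erase r, f i + f r := by
        rw [sum_erase_add _ _ hrS]
      have hf' := hf
      rw [← insert_erase hrS, feasible_insert hT] at hf'
      obtain ⟨h₁, h₂, h₃⟩ := ih (by omega) hT hf'.1
      have hkx : ∑ i ∈ S.erase r, κ i = x - κ r := by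
        rw [hx, hsum κ, Nat.add_sub_cancel]
      have hle : κ r ≤ x := by
        rw [hx, hsum κ]
        exact Nat.le_add_left _ _
      rw [hkx] at h₁ h₂ h₃
      set c := table p d w κ r (x - κ r) with hc
      have hstep : e = Entry.step (p r) (d r) (w r) o c := by
        rw [he, table, if_pos hle]
      -- The candidate passes the due date test because it is no later than `S` without `r`. It is
      -- thus rejected only in favour of an entry whose weight minus time is at least as large.
      have hB : 0 < e.tag ∧ (e = ⟨2, c.time + p r, c.weight + w r⟩ ∨
          (e = ⟨1, o.time, o.weight⟩ ∧
            o.time + (c.weight + w r) ≤ c.time + p r + o.weight)) := by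
        rw [hstep, Entry.step]
        have hd : c.time + p r ≤ d r := by omega
        split_ifs with h h'
        · exact ⟨by simp, .inl rfl⟩
        · refine ⟨by simp, .inr ⟨rfl, ?_⟩⟩
          by_contra hcon
          exact h ⟨h₁, hd, .inr (by omega)⟩
        · exact absurd ⟨h₁, hd, .inl (by omega)⟩ h
      have hp := hsum p
      have hw := hsum w
      refine ⟨hB.1, ?_⟩
      have hcm := hcmp hB.1 S hS rfl
      rcases hB.2 with h | ⟨h, hle'⟩ <;> rw [h] at hcm ⊢ <;> dsimp only at hcm ⊢ <;> omega
    · have hT : S ⊆ range r := by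
        intro i hi
        have := mem_range.1 (hS hi)
        have : i ≠ r := fun h => hrS (h ▸ hi)
        exact mem_range.2 (by omega)
      obtain ⟨h₁, h₂, h₃⟩ := ih (by omega) hT hf
      rw [← hx, ← ho] at h₁ h₂ h₃
      have hA : 0 < e.tag ∧ (e = ⟨1, o.time, o.weight⟩ ∨
          e.time + o.weight < o.time + e.weight) := by
        rw [he, table, ← ho, Entry.step]
        generalize (if κ r ≤ x then table p d w κ r (x - κ r) else ⟨0, 0, 0⟩) = c
        split_ifs with h
        · exact ⟨by simp, .inr (h.2.2.resolve_left h₁.ne')⟩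
        · exact ⟨by simp, .inl rfl⟩
      refine ⟨hA.1, ?_⟩
      have hcm := hcmp hA.1 S hS rfl
      rcases hA.2 with h | h
      · rw [h]
        exact ⟨h₂, h₃⟩
      · omega

end DynamicProgram

/-! ### Keys -/

theorem sum_mul_pow_lt {n : ℕ} {f : ℕ → ℕ} (hf : ∀ c, f c ≤ n) (m : ℕ) :
    ∑ c ∈ range m, f c * (n + 1) ^ c < (n + 1) ^ m := by
  induction m with
  | zero => simp
  | succ m ih =>
    rw [sum_range_succ, pow_succ]
    nlinarith [Nat.mul_le_mul_right ((n + 1) ^ m) (hf m)]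

/-- Uniqueness of the digits in base `n + 1`: division by the highest power isolates the leading
digit. -/
theorem eq_of_sum_mul_pow_eq {n : ℕ} {f g : ℕ → ℕ} (hf : ∀ c, f c ≤ n) (hg : ∀ c, g c ≤ n)
    {m : ℕ} (h : ∑ c ∈ range m, f c * (n + 1) ^ c = ∑ c ∈ range m, g c * (n + 1) ^ c) :
    ∀ c < m, f c = g c := by
  induction m with
  | zero => simp
  | succ m ih =>
    have hm : f m = g m := by
      have hdiv (f : ℕ → ℕ) (hf : ∀ c, f c ≤ n) :
          (∑ c ∈ range (m + 1), f c * (n + 1) ^ c) / (n + 1) ^ m = f m := by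
        rw [sum_range_succ, Nat.add_mul_div_right _ _ (by positivity),
          Nat.div_eq_of_lt (sum_mul_pow_lt hf m), Nat.zero_add]
      rw [← hdiv f hf, ← hdiv g hg, h]
    rw [sum_range_succ, sum_range_succ, hm] at h
    intro c hc
    rcases Nat.lt_succ_iff_lt_or_eq.1 hc with hc | rfl
    exacts [ih (Nat.add_right_cancel h) c hc, hm]

theorem sum_comp_eq {n m : ℕ} {e : ℕ → ℕ} (he : ∀ r < n, e r < m) {S : Finset ℕ}
    (hS : S ⊆ range n) (g : ℕ → ℕ) :
    ∑ i ∈ S, g (e i) = ∑ c ∈ range m, #{i ∈ S | e i = c} * g c := by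
  rw [← sum_fiberwise_of_maps_to (t := range m) (g := e)
    (fun i hi => mem_range.2 (he i (mem_range.1 (hS hi))))]
  refine sum_congr rfl fun c _ => ?_
  rw [sum_congr rfl (g := fun _ => g c) fun i hi => by rw [(mem_filter.1 hi).2], sum_const,
    smul_eq_mul]

theorem card_filter_le_of_subset_range {n : ℕ} {S : Finset ℕ} (hS : S ⊆ range n) (q : ℕ → Prop)
    [DecidablePred q] : #{i ∈ S | q i} ≤ n :=
  (card_le_card ((filter_subset _ _).trans hS)).trans (card_range n).le

/-- No set of jobs leaves the table: a class contains at most `n` of them, so there is no carry. -/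
theorem sum_pow_lt {n m : ℕ} {e : ℕ → ℕ} (he : ∀ r < n, e r < m) {S : Finset ℕ}
    (hS : S ⊆ range n) : ∑ i ∈ S, (n + 1) ^ e i < (n + 1) ^ m := by
  rw [sum_comp_eq he hS fun c => (n + 1) ^ c]
  exact sum_mul_pow_lt (fun c => card_filter_le_of_subset_range hS _) m

/-- If `v` only depends on the class `e`, then the sum of the keys `(n + 1) ^ e i` determines the
sum of the values of `v`. -/
theorem sum_eq_of_sum_pow_eq {n m : ℕ} {e v : ℕ → ℕ} (he : ∀ r < n, e r < m)
    (hv : ∀ r < n, ∀ q < n, e r = e q → v r = v q) {S T : Finset ℕ} (hS : S ⊆ range n)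
    (hT : T ⊆ range n) (h : ∑ i ∈ S, (n + 1) ^ e i = ∑ i ∈ T, (n + 1) ^ e i) :
    ∑ i ∈ S, v i = ∑ i ∈ T, v i := by
  -- `v` factors through the class; the value `0` on empty classes plays no role.
  obtain ⟨u, hu⟩ : ∃ u : ℕ → ℕ, ∀ r < n, v r = u (e r) := by
    classical
    refine ⟨fun c => if hc : ∃ r < n, e r = c then v hc.choose else 0, fun r hr => ?_⟩
    have hc : ∃ q < n, e q = e r := ⟨r, hr, rfl⟩
    dsimp only
    rw [dif_pos hc]
    exact hv r hr _ hc.choose_spec.1 hc.choose_spec.2.symm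
  rw [sum_comp_eq he hS fun c => (n + 1) ^ c, sum_comp_eq he hT fun c => (n + 1) ^ c] at h
  have hcard := eq_of_sum_mul_pow_eq (fun c => card_filter_le_of_subset_range hS _)
    (fun c => card_filter_le_of_subset_range hT _) h
  rw [sum_congr rfl fun i hi => hu i (mem_range.1 (hS hi)),
    sum_congr rfl fun i hi => hu i (mem_range.1 (hT hi)), sum_comp_eq he hS, sum_comp_eq he hT]
  exact sum_congr rfl fun c hc => by rw [hcard c (mem_range.1 hc)]

/-! ### Ranks -/

/-- Job `k` comes before job `i` in the order of the due dates, ties being broken by the index. -/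
def Precedes (d : ℕ → ℕ) (k i : ℕ) : Prop := d k < d i ∨ d k = d i ∧ k < i

instance (d : ℕ → ℕ) (i : ℕ) : DecidablePred fun k => Precedes d k i := fun _ =>
  inferInstanceAs (Decidable (_ ∨ _))

theorem not_precedes_self (d : ℕ → ℕ) (i : ℕ) : ¬ Precedes d i i := by simp [Precedes]

/-- The number of jobs among the first `m` that come before job `i`. -/
def rank (d : ℕ → ℕ) (m i : ℕ) : ℕ := #{k ∈ range m | Precedes d k i}

theorem rank_succ (d : ℕ → ℕ) (m i : ℕ) :
    rank d (m + 1) i = if Precedes d m i then rank d m i + 1 else rank d m i := by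
  rw [rank, range_add_one, filter_insert]
  split_ifs
  · rw [card_insert_of_notMem (by simp), rank]
  · rfl

theorem rank_lt_rank {d : ℕ → ℕ} {n i j : ℕ} (hi : i < n) (h : Precedes d i j) :
    rank d n i < rank d n j := by
  refine card_lt_card (ssubset_iff_of_subset ?_ |>.2 ⟨i, ?_, ?_⟩)
  · intro k hk
    obtain ⟨hk, hk'⟩ := mem_filter.1 hk
    refine mem_filter.2 ⟨hk, ?_⟩
    unfold Precedes at *
    omega
  · exact mem_filter.2 ⟨mem_range.2 hi, h⟩
  · simp [not_precedes_self]

theorem rank_lt {d : ℕ → ℕ} {n i : ℕ} (hi : i < n) : rank d n i < n := by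
  have : rank d n i < #(range n) := by
    refine card_lt_card (ssubset_iff_of_subset (filter_subset _ _) |>.2 ⟨i, mem_range.2 hi, ?_⟩)
    simp [not_precedes_self]
  rwa [card_range] at this

theorem rank_injective {d : ℕ → ℕ} {n i j : ℕ} (hi : i < n) (hj : j < n)
    (h : rank d n i = rank d n j) : i = j := by
  by_contra hij
  have : Precedes d i j ∨ Precedes d j i := by
    unfold Precedes
    omega
  rcases this with h' | h'
  · exact (rank_lt_rank hi h').ne h
  · exact (rank_lt_rank hj h').ne' h

theorem le_of_rank_le {d : ℕ → ℕ} {n i j : ℕ} (hj : j < n) (h : rank d n i ≤ rank d n j) :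
    d i ≤ d j := by
  by_contra hd
  exact absurd (rank_lt_rank hj (show Precedes d j i from .inl (by omega))) (not_lt.2 h)

/-! ### From a feasible set of jobs to an optimal schedule -/

/-- The position of the `r`-th job when the jobs of `T` come first, in their order, and the other
jobs come last, in reverse order. -/
def position (T : Finset ℕ) (n r : ℕ) : ℕ :=
  if r ∈ T then #{i ∈ range r | i ∈ T} else n - 1 - #{i ∈ range r | i ∉ T}

theorem card_filter_range_lt {q : ℕ → Prop} [DecidablePred q] {r m : ℕ} (hr : r < m) (h : q r) :
    #{i ∈ range r | q i} < #{i ∈ range m | q i} := by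
  refine card_lt_card (ssubset_iff_of_subset ?_ |>.2 ⟨r, by simp [hr, h], by simp⟩)
  exact filter_subset_filter _ (range_subset_range.2 hr.le)

theorem card_filter_range_add (T : Finset ℕ) (n : ℕ) :
    #{i ∈ range n | i ∈ T} + #{i ∈ range n | i ∉ T} = n := by
  rw [card_filter_add_card_filter_not, card_range]

theorem position_lt {T : Finset ℕ} {n r : ℕ} (hr : r < n) : position T n r < n := by
  unfold position
  split_ifs with h
  · have := card_filter_range_lt (q := fun i => i ∈ T) hr h
    have := card_filter_range_add T n
    omega
  · omega

theorem position_lt_position {T : Finset ℕ} {n r q : ℕ} (hr : r < n) (hq : q < n) (hrT : r ∈ T)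
    (h : q ∉ T ∨ r < q) : position T n r < position T n q := by
  have hadd := card_filter_range_add T n
  have h₁ := card_filter_range_lt (q := fun i => i ∈ T) hr hrT
  unfold position
  rw [if_pos hrT]
  split_ifs with hqT
  · exact card_filter_range_lt (h.resolve_left (not_not.2 hqT)) hrT
  · have h₂ := card_filter_range_lt (q := fun i => i ∉ T) hq hqT
    omega

/-- The jobs of `T` fill the positions from the front and the others from the back; the two counts
add up to `n`, so they do not meet. Filling from both ends permits output in one pass without
knowing the size of `T`. -/
theorem position_injective {T : Finset ℕ} {n r q : ℕ} (hr : r < n) (hq : q < n)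
    (h : position T n r = position T n q) : r = q := by
  by_contra hne
  by_cases hrT : r ∈ T
  · by_cases hqT : q ∈ T
    · rcases Nat.lt_or_gt_of_ne hne with hlt | hlt
      · exact (position_lt_position hr hq hrT (.inr hlt)).ne h
      · exact (position_lt_position hq hr hqT (.inr hlt)).ne' h
    · exact (position_lt_position hr hq hrT (.inl hqT)).ne h
  · by_cases hqT : q ∈ T
    · exact (position_lt_position hq hr hqT (.inl hrT)).ne' h
    · have h₁ := card_filter_range_lt (q := fun i => i ∉ T) hr hrT
      have h₂ := card_filter_range_lt (q := fun i => i ∉ T) hq hqT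
      have hadd := card_filter_range_add T n
      simp only [position, if_neg hrT, if_neg hqT] at h
      rcases Nat.lt_or_gt_of_ne hne with hlt | hlt
      · have := card_filter_range_lt (q := fun i => i ∉ T) hlt hrT
        omega
      · have := card_filter_range_lt (q := fun i => i ∉ T) hlt hqT
        omega

/-- The permutation of `Fin n` given by a function on numbers. -/
noncomputable def permOfInjOn {n : ℕ} (f : ℕ → ℕ) (hf : ∀ i < n, f i < n)
    (hinj : ∀ i < n, ∀ j < n, f i = f j → i = j) : Equiv.Perm (Fin n) :=
  Equiv.ofBijective (fun i => ⟨f i, hf i i.2⟩) (Finite.injective_iff_bijective.1 fun i j h =>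
    Fin.ext (hinj i i.2 j j.2 (Fin.mk.inj_iff.1 h)))

theorem Instance.tardyWeight_add {n : ℕ} (I : Instance n) (π : Equiv.Perm (Fin n)) :
    I.tardyWeight π + ∑ j with I.completionTime π j ≤ I.d j, I.w j = ∑ j, I.w j := by
  have := sum_filter_add_sum_filter_not univ (fun j => I.d j < I.completionTime π j) I.w
  simp only [not_lt] at this
  exact this

/-- Minimal tardy weight is maximal early weight. In `π` all of `T` is early. Conversely, the early
jobs of any `σ` form a feasible set: those up to `j` in due date order are all finished when the
last of them in `σ` is, hence by a due date that is at most that of `j`. -/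
theorem isOptimal_of_feasible {n : ℕ} {I : Instance n} {p d w : ℕ → ℕ} {ρ π : Equiv.Perm (Fin n)}
    (hp : ∀ j, p (ρ j) = I.p j) (hd : ∀ j, d (ρ j) = I.d j) (hw : ∀ j, w (ρ j) = I.w j)
    (hmono : ∀ r < n, ∀ q ≤ r, d q ≤ d r) {T : Finset ℕ} (hT : T ⊆ range n)
    (hfeas : Feasible p d T)
    (hbest : ∀ S ⊆ range n, Feasible p d S → ∑ i ∈ S, w i ≤ ∑ i ∈ T, w i)
    (hπ : ∀ j, (π j : ℕ) = position T n (ρ j)) : I.IsOptimal π := by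
  have hinj : Function.Injective fun j => (ρ j : ℕ) := fun i j h => ρ.injective (Fin.ext h)
  have hmap (f g : ℕ → ℕ) (A : Finset (Fin n)) : ∑ r ∈ A.image fun j => (ρ j : ℕ), f r =
      ∑ j ∈ A, f (ρ j) := sum_image fun _ _ _ _ h => hinj h
  have hmem : ∀ r ∈ T, ∃ j, (ρ j : ℕ) = r := fun r hr =>
    ⟨ρ.symm ⟨r, mem_range.1 (hT hr)⟩, by simp⟩
  -- the jobs of `T` are early in `π`
  have hearly : ∀ j, (ρ j : ℕ) ∈ T → I.completionTime π j ≤ I.d j := by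
    intro j hj
    rw [← hd]
    refine le_trans ?_ (hfeas _ hj)
    unfold Instance.completionTime
    rw [sum_congr rfl fun i _ => (hp i).symm, ← hmap p p]
    refine sum_le_sum_of_subset fun r hr => ?_
    obtain ⟨i, hi, rfl⟩ := mem_image.1 hr
    have hi' : (π i : ℕ) ≤ π j := (mem_filter.1 hi).2
    rw [hπ, hπ] at hi'
    -- A job outside `T`, or one of `T` after `j` in due date order, would have a later position
    -- than `j`.
    by_contra hcon
    refine absurd (position_lt_position (ρ j).2 (ρ i).2 hj ?_) (not_lt.2 hi')
    simp only [mem_filter, not_and_or, not_le] at hcon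
    exact hcon
  have hTw : ∑ i ∈ T, w i ≤ ∑ j with I.completionTime π j ≤ I.d j, I.w j := by
    rw [sum_congr rfl fun i _ => (hw i).symm, ← hmap w w]
    refine sum_le_sum_of_subset fun r hr => ?_
    obtain ⟨j, rfl⟩ := hmem r hr
    exact mem_image.2 ⟨j, by simpa using hearly j hr, rfl⟩
  intro σ
  have hσ : ∑ j with I.completionTime σ j ≤ I.d j, I.w j ≤ ∑ i ∈ T, w i := by
    rw [sum_congr rfl fun i _ => (hw i).symm, ← hmap w w]
    refine hbest _ ?_ ?_
    · intro r hr
      obtain ⟨j, -, rfl⟩ := mem_image.1 hr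
      exact mem_range.2 (ρ j).2
    · intro r hr
      obtain ⟨j, hj, rfl⟩ := mem_image.1 hr
      -- among the early jobs up to `j`, let `m` be the one that is processed last
      set A : Finset (Fin n) :=
        {i | I.completionTime σ i ≤ I.d i ∧ (ρ i : ℕ) ≤ ρ j} with hA
      obtain ⟨m, hm, hmax⟩ := A.exists_max_image σ ⟨j, by simpa [hA] using hj⟩
      have hm' := (mem_filter.1 hm).2
      calc _ = ∑ i ∈ A, I.p i := by
            rw [sum_congr rfl fun i _ => (hp i).symm, ← hmap p p]
            congr 1
            ext r
            simp only [mem_filter, mem_image, hA, mem_univ, true_and]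
            constructor
            · rintro ⟨⟨i, hi, rfl⟩, h⟩
              exact ⟨i, ⟨hi, h⟩, rfl⟩
            · rintro ⟨i, ⟨hi, h⟩, rfl⟩
              exact ⟨⟨i, hi, rfl⟩, h⟩
        _ ≤ I.completionTime σ m :=
            sum_le_sum_of_subset fun i hi => by simpa using hmax i hi
        _ ≤ I.d m := hm'.1
        _ = d (ρ m) := (hd m).symm
        _ ≤ d (ρ j) := hmono _ (ρ j).2 _ hm'.2
  have h₁ := I.tardyWeight_add π
  have h₂ := I.tardyWeight_add σ
  omega

open TardyJobs.Expr TardyJobs.Prog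

/-! ### The program: sorting the jobs by their due dates -/

infixr:50 " ;; " => Prog.seq

def mul3 (e : Expr) : Expr := add (add e e) e

def mul6 (e : Expr) : Expr := mul3 (add e e)

/-- The address of a field of an input job. -/
def input (e : Expr) (f : ℕ) : Expr := add (mul3 e) (const f)

/-- The address of a field of a record in the sorted list. Fields `0`, …, `5` are the processing
time, the due date, the weight, the index of the job, the key and the early flag. -/
def field (e : Expr) (f : ℕ) : Expr := add (add (reg 1) (mul6 e)) (const f)

def inc (r : ℕ) : Prog := set r (add (reg r) (const 1))

@[simp] theorem eval_mul3 (s : State) (e : Expr) : (mul3 e).eval s = 3 * e.eval s := by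
  simp only [mul3, eval]
  omega

@[simp] theorem eval_mul6 (s : State) (e : Expr) : (mul6 e).eval s = 6 * e.eval s := by
  simp only [mul6, eval_mul3, eval]
  omega

@[simp] theorem eval_input (s : State) (e : Expr) (f : ℕ) :
    (input e f).eval s = 3 * e.eval s + f := by
  simp [input, eval]

@[simp] theorem eval_field (s : State) (e : Expr) (f : ℕ) :
    (field e f).eval s = s.reg 1 + 6 * e.eval s + f := by
  simp [field, eval]

/-- Register `0` holds the number of jobs, register `1` the address of the sorted list and
register `2` the address of the table. -/
structure Header (n : ℕ) (s : State) : Prop where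
  reg0 : s.reg 0 = n
  reg1 : s.reg 1 = 3 * n + 1
  reg2 : s.reg 2 = 9 * n + 1

theorem Header.congr {n : ℕ} {s s' : State} (h : Header n s) (h₀ : s'.reg 0 = s.reg 0)
    (h₁ : s'.reg 1 = s.reg 1) (h₂ : s'.reg 2 = s.reg 2) : Header n s' :=
  ⟨h₀.trans h.1, h₁.trans h.2, h₂.trans h.3⟩

def setup : Prog :=
  set 0 (load (const 0)) ;; set 1 (add (mul3 (reg 0)) (const 1)) ;;
    set 2 (add (reg 1) (mul6 (reg 0)))

/-- Register `3` is the job being ranked, register `4` its competitor and register `5` the count.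
The outer test breaks ties by the index, as in `Precedes`. -/
def compareStep : Prog :=
  cond (reg 4) (reg 3)
    (cond (load (input (reg 3) 2)) (load (input (reg 4) 2)) skip (inc 5))
    (cond (load (input (reg 4) 2)) (load (input (reg 3) 2)) (inc 5) skip) ;;
  inc 4

def copyJob : Prog :=
  store (field (reg 5) 0) (load (input (reg 3) 1)) ;;
  store (field (reg 5) 1) (load (input (reg 3) 2)) ;;
  store (field (reg 5) 2) (load (input (reg 3) 3)) ;;
  store (field (reg 5) 3) (reg 3) ;; inc 3

/-- Each job is copied straight to the place given by its rank. The quadratic number of comparisons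
stays within the cost of the table. -/
def sortJobs : Prog :=
  set 3 (const 0) ;;
  loop (reg 3) (reg 0)
    ((set 5 (const 0) ;; set 4 (const 0)) ;; loop (reg 4) (reg 0) compareStep ;; copyJob)

/-- `flag` and `free` preserve zeros for later phases: the early flags start at `0`, and row `0` of
the table relies on blank memory. -/
structure SortInv (n : ℕ) (p d w : ℕ → ℕ) (i : ℕ) (s : State) : Prop where
  header : Header n s
  reg3 : s.reg 3 = i
  input : ∀ j < n, s.mem (3 * j + 1) = p j ∧ s.mem (3 * j + 2) = d j ∧ s.mem (3 * j + 3) = w j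
  record : ∀ j < i, s.mem (3 * n + 1 + 6 * rank d n j) = p j ∧
    s.mem (3 * n + 1 + 6 * rank d n j + 1) = d j ∧
    s.mem (3 * n + 1 + 6 * rank d n j + 2) = w j ∧
    s.mem (3 * n + 1 + 6 * rank d n j + 3) = j
  flag : ∀ r < n, s.mem (3 * n + 1 + 6 * r + 5) = 0
  free : ∀ a, 9 * n + 1 ≤ a → s.mem a = 0

theorem wp_compareLoop {n : ℕ} {p d w : ℕ → ℕ} {i : ℕ} (hi : i < n) {s₀ : State}
    (h : SortInv n p d w i s₀) (h4 : s₀.reg 4 = 0) (h5 : s₀.reg 5 = 0) :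
    WP (loop (reg 4) (reg 0) compareStep) (n + 1)
      (fun s => SortInv n p d w i s ∧ s.reg 5 = rank d n i) s₀ := by
  have := WP.loop (a := reg 4) (b := reg 0) (P := compareStep) (c := 1) (N := n) (s := s₀)
    (fun k s => s.mem = s₀.mem ∧ s.reg 0 = s₀.reg 0 ∧ s.reg 1 = s₀.reg 1 ∧ s.reg 2 = s₀.reg 2 ∧
      s.reg 3 = i ∧ s.reg 4 = k ∧ s.reg 5 = rank d k i)
    le_rfl ⟨rfl, rfl, rfl, rfl, h.reg3, h4, by simp [h5, rank]⟩ ?_ ?_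
  · refine this.mono (by omega) ?_
    rintro s ⟨hm, h0, h1, h2, h3, -, h5⟩
    exact ⟨⟨h.header.congr h0 h1 h2, h3, hm ▸ h.input, hm ▸ h.record, hm ▸ h.flag,
      hm ▸ h.free⟩, h5⟩
  · rintro k hk s ⟨hm, h0, h1, h2, h3, h4, h5⟩
    refine ⟨by simp [eval, h4, h0, h.header.reg0, hk], .exec rfl le_rfl ?_⟩
    have hdi := (h.input i hi).2.1
    have hdk := (h.input k hk).2.1
    simp only [compareStep, Prog.exec, inc, eval, eval_input, hm, h3, h4, hdi, hdk]
    by_cases hP : Precedes d k i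
    · rw [rank_succ, if_pos hP]
      unfold Precedes at hP
      split_ifs <;> first | omega | simp [h0, h1, h2, h3, h4, h5]
    · rw [rank_succ, if_neg hP]
      unfold Precedes at hP
      split_ifs <;> first | omega | simp [h0, h1, h2, h3, h4, h5, hm]
  · rintro s ⟨hm, h0, h1, h2, h3, h4, h5⟩
    simp [eval, h4, h0, h.header.reg0]

theorem wp_sortJobs {n : ℕ} {p d w : ℕ → ℕ} {s₀ : State} (h : Header n s₀)
    (hin : ∀ j < n, s₀.mem (3 * j + 1) = p j ∧ s₀.mem (3 * j + 2) = d j ∧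
      s₀.mem (3 * j + 3) = w j) (hfree : ∀ a, 3 * n + 1 ≤ a → s₀.mem a = 0) :
    WP sortJobs ((n + 1) * (n + 1)) (SortInv n p d w n) s₀ := by
  refine .seq (.exec rfl (by nlinarith) ?_)
  refine WP.loop (SortInv n p d w) (by omega) ?_ ?_ ?_
  · simp only [Prog.exec, eval]
    exact ⟨h.congr (by simp) (by simp) (by simp), by simp, hin, by simp,
      fun r hr => hfree _ (by omega), fun a ha => hfree _ (by omega)⟩
  · intro i hi s hs
    refine ⟨by simp [eval, hs.reg3, hs.header.reg0, hi], .seq (.exec rfl (by omega) ?_)⟩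
    refine .seq ((wp_compareLoop (p := p) (d := d) (w := w) hi ?_ (by simp [Prog.exec, eval])
      (by simp [Prog.exec, eval])).mono le_rfl ?_)
    · simp only [Prog.exec, eval]
      exact ⟨hs.header.congr (by simp) (by simp) (by simp), by simp [hs.reg3], hs.input,
        hs.record, hs.flag, hs.free⟩
    · rintro s ⟨hs, h5⟩
      refine .exec rfl (by omega) ?_
      have hr := rank_lt (d := d) hi
      obtain ⟨hp, hd, hw⟩ := hs.input i hi
      have hinj : ∀ j < i, rank d n j ≠ rank d n i := fun j hj h =>
        absurd (rank_injective (by omega) hi h) (by omega)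
      simp only [copyJob, Prog.exec, inc, eval, eval_input, eval_field, hs.reg3, h5,
        hs.header.reg1]
      have hlt : ∀ j < i, rank d n j < n := fun j hj => rank_lt (by omega)
      have hrec := hs.record
      set ri := rank d n i
      refine ⟨hs.header.congr (by simp) (by simp) (by simp), by simp,
        fun j hj => ?_, fun j hj => ?_, fun r hr => ?_, fun a ha => ?_⟩
      · simp (disch := omega) only [Function.update_of_ne]
        exact hs.input j hj
      · rcases Nat.lt_succ_iff_lt_or_eq.1 hj with hj | rfl
        · have := hinj j hj
          have := hlt j hj
          simp (disch := omega) only [Function.update_of_ne]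
          exact hrec j hj
        · rw [show rank d n j = ri from rfl]
          simp (disch := omega) only [Function.update_of_ne, Function.update_self, Nat.add_zero,
            hp, hd, hw, and_self]
      · simp (disch := omega) only [Function.update_of_ne]
        exact hs.flag r hr
      · simp (disch := omega) only [Function.update_of_ne]
        exact hs.free a ha
  · intro s hs
    simp [eval, hs.reg3, hs.header.reg0]

/-- The sorted list holds the jobs `a 0, a 1, …`, which have the parameters `p`, `d` and `w`. -/
structure Records (n : ℕ) (p d w a : ℕ → ℕ) (s : State) : Prop where
  header : Header n s
  p : ∀ r < n, s.mem (3 * n + 1 + 6 * r) = p r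
  d : ∀ r < n, s.mem (3 * n + 1 + 6 * r + 1) = d r
  w : ∀ r < n, s.mem (3 * n + 1 + 6 * r + 2) = w r
  a : ∀ r < n, s.mem (3 * n + 1 + 6 * r + 3) = a r

theorem Records.congr {n : ℕ} {p d w a : ℕ → ℕ} {s s' : State} (h : Records n p d w a s)
    (h' : Header n s') (hmem : ∀ r < n, ∀ f < 4, s'.mem (3 * n + 1 + 6 * r + f) =
      s.mem (3 * n + 1 + 6 * r + f)) : Records n p d w a s' :=
  ⟨h', fun r hr => (hmem r hr 0 (by omega)).trans (h.p r hr),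
    fun r hr => (hmem r hr 1 (by omega)).trans (h.d r hr),
    fun r hr => (hmem r hr 2 (by omega)).trans (h.w r hr),
    fun r hr => (hmem r hr 3 (by omega)).trans (h.a r hr)⟩

/-- `a` inverts the rank, which is a permutation; it passes from indexing by jobs to indexing by
places in the sorted list. -/
theorem SortInv.exists_records {n : ℕ} {p d w : ℕ → ℕ} {s : State} (h : SortInv n p d w n s) :
    ∃ a : ℕ → ℕ, (∀ r < n, a r < n ∧ rank d n (a r) = r) ∧
      Records n (fun r => p (a r)) (fun r => d (a r)) (fun r => w (a r)) a s := by
  let ρ : Equiv.Perm (Fin n) := permOfInjOn (rank d n) (fun _ => rank_lt)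
    (fun _ hi _ hj => rank_injective hi hj)
  have hex : ∀ r, ∃ j, r < n → j < n ∧ rank d n j = r := by
    intro r
    by_cases hr : r < n
    · exact ⟨ρ.symm ⟨r, hr⟩, fun _ => ⟨Fin.is_lt _, congrArg Fin.val (ρ.apply_symm_apply ⟨r, hr⟩)⟩⟩
    · exact ⟨0, fun h => absurd h hr⟩
  choose a ha using hex
  refine ⟨a, ha, h.header, fun r hr => ?_, fun r hr => ?_, fun r hr => ?_, fun r hr => ?_⟩
  all_goals
    have := h.record (a r) (ha r hr).1
    rw [(ha r hr).2] at this
  exacts [this.1, this.2.1, this.2.2.1, this.2.2.2]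

/-! ### The program: keys -/

/-- Two failing strict comparisons mean equal values; the key of the earlier job is then reused. -/
def keyScan (f : ℕ) : Prog :=
  cond (load (field (reg 4) f)) (load (field (reg 3) f)) skip
    (cond (load (field (reg 3) f)) (load (field (reg 4) f)) skip
      (set 5 (load (field (reg 4) 4)))) ;;
  inc 4

/-- Multiplication is unavailable. Register `7` keeps the old power, and adding it `n` times to
register `6` multiplies that register by `n + 1`. -/
def multiplyStep : Prog := set 6 (add (reg 6) (reg 7)) ;; inc 4

/-- Jobs receive the same key if and only if they have the same value in field `f`. -/
def assignKeys (f : ℕ) : Prog :=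
  (set 6 (const 1) ;; set 3 (const 0)) ;;
  loop (reg 3) (reg 0)
    ((set 5 (reg 6) ;; set 4 (const 0)) ;;
     loop (reg 4) (reg 3) (keyScan f) ;;
     store (field (reg 3) 4) (reg 5) ;;
     cond (reg 5) (reg 6) skip
       ((set 7 (reg 6) ;; set 4 (const 0)) ;; loop (reg 4) (reg 0) multiplyStep) ;;
     inc 3)

/-- The keys of the first `i` jobs are `(n + 1) ^ e 0, (n + 1) ^ e 1, …`. -/
structure KeyInv (n : ℕ) (v : ℕ → ℕ) (s₀ : State) (e : ℕ → ℕ) (i : ℕ) (s : State) : Prop where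
  header : Header n s
  reg3 : s.reg 3 = i
  reg6 : s.reg 6 = (n + 1) ^ #((range i).image v)
  lt : ∀ q < i, e q < #((range i).image v)
  eq : ∀ q < i, ∀ r < i, e q = e r → v q = v r
  key : ∀ q < i, s.mem (3 * n + 1 + 6 * q + 4) = (n + 1) ^ e q
  frame : ∀ a, (∀ q < n, a ≠ 3 * n + 1 + 6 * q + 4) → s.mem a = s₀.mem a

theorem wp_keyScan {n : ℕ} {v e : ℕ → ℕ} {s₀ s₁ : State} {f i : ℕ} (hf : f < 4)
    (hv : ∀ r < n, s₀.mem (3 * n + 1 + 6 * r + f) = v r) (hi : i < n)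
    (h : KeyInv n v s₀ e i s₁) (h4 : s₁.reg 4 = 0) (h5 : s₁.reg 5 = s₁.reg 6) :
    WP (loop (reg 4) (reg 3) (keyScan f)) (n + 1)
      (fun s => KeyInv n v s₀ e i s ∧
        ((v i ∉ (range i).image v ∧ s.reg 5 = s.reg 6) ∨
          ∃ q < i, v q = v i ∧ s.reg 5 = (n + 1) ^ e q)) s₁ := by
  have := WP.loop (a := reg 4) (b := reg 3) (P := keyScan f) (c := 1) (N := i) (s := s₁)
    (fun k s => s.mem = s₁.mem ∧ s.reg 0 = s₁.reg 0 ∧ s.reg 1 = s₁.reg 1 ∧ s.reg 2 = s₁.reg 2 ∧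
      s.reg 3 = i ∧ s.reg 4 = k ∧ s.reg 6 = s₁.reg 6 ∧
      (((∀ q < k, v q ≠ v i) ∧ s.reg 5 = s.reg 6) ∨
          ∃ q < k, v q = v i ∧ s.reg 5 = (n + 1) ^ e q))
    le_rfl ⟨rfl, rfl, rfl, rfl, h.reg3, h4, rfl, .inl ⟨by simp, h5⟩⟩ ?_ ?_
  · refine this.mono (by omega) ?_
    rintro s ⟨hm, h0, h1, h2, h3, -, h6, h5⟩
    refine ⟨⟨h.header.congr h0 h1 h2, h3, h6.trans h.reg6, h.lt, h.eq, hm ▸ h.key,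
      hm ▸ h.frame⟩, h5.imp_left fun h => ⟨?_, h.2⟩⟩
    simpa using h.1
  · rintro k hk s ⟨hm, h0, h1, h2, h3, h4, h6, h5⟩
    refine ⟨by simp [eval, h4, h3, hk], .exec rfl le_rfl ?_⟩
    have hvi : s₁.mem (3 * n + 1 + 6 * i + f) = v i := by
      rw [h.frame _ (by omega), hv i hi]
    have hvk : s₁.mem (3 * n + 1 + 6 * k + f) = v k := by
      rw [h.frame _ (by omega), hv k (by omega)]
    have hkey := h.key k hk
    simp only [keyScan, Prog.exec, inc, eval, eval_field, hm, h3, h4, h1, h.header.reg1, hvi, hvk]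
    by_cases hvv : v k = v i
    · rw [if_neg (by omega), if_neg (by omega)]
      refine ⟨by simp, by simp [h0], by simp [h1, h.header.reg1], by simp [h2], by simp [h3], by simp [h4],
        by simp [h6], .inr ⟨k, by omega, hvv, ?_⟩⟩
      simp [hkey]
    · have hskip : ∀ s', (if v k < v i then s else if v i < v k then s else s') = s := by
        intro s'
        split_ifs <;> first | rfl | omega
      rw [hskip]
      refine ⟨hm, by simp [h0], by simp [h1, h.header.reg1], by simp [h2], by simp [h3], by simp [h4],
        by simp [h6], ?_⟩
      rcases h5 with ⟨h5, h5'⟩ | ⟨q, hq, h5⟩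
      · refine .inl ⟨fun q hq => ?_, by simpa using h5'⟩
        rcases Nat.lt_succ_iff_lt_or_eq.1 hq with hq | rfl
        exacts [h5 q hq, hvv]
      · exact .inr ⟨q, by omega, by simpa using h5⟩
  · rintro s ⟨hm, h0, h1, h2, h3, h4, h5⟩
    simp [eval, h4, h3]

theorem wp_multiply {n : ℕ} {s₁ : State} (h0 : s₁.reg 0 = n) (h4 : s₁.reg 4 = 0)
    (h7 : s₁.reg 7 = s₁.reg 6) :
    WP (loop (reg 4) (reg 0) multiplyStep) (n + 1)
      (fun s => s.mem = s₁.mem ∧ s.reg 0 = s₁.reg 0 ∧ s.reg 1 = s₁.reg 1 ∧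
        s.reg 2 = s₁.reg 2 ∧ s.reg 3 = s₁.reg 3 ∧ s.reg 6 = s₁.reg 6 * (n + 1)) s₁ := by
  have := WP.loop (a := reg 4) (b := reg 0) (P := multiplyStep) (c := 1) (N := n) (s := s₁)
    (fun k s => s.mem = s₁.mem ∧ s.reg 0 = s₁.reg 0 ∧ s.reg 1 = s₁.reg 1 ∧ s.reg 2 = s₁.reg 2 ∧
      s.reg 3 = s₁.reg 3 ∧ s.reg 6 = s₁.reg 6 * (k + 1) ∧ s.reg 4 = k ∧ s.reg 7 = s₁.reg 6)
    le_rfl ⟨rfl, rfl, rfl, rfl, rfl, by simp, h4, h7⟩ ?_ ?_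
  · refine this.mono (by omega) ?_
    rintro s ⟨hm, h0, h1, h2, h3, h6, -⟩
    exact ⟨hm, h0, h1, h2, h3, h6⟩
  · rintro k hk s ⟨hm, h0', h1, h2, h3, h6, h4, h7⟩
    refine ⟨by simp [eval, h4, h0', h0, hk], .exec rfl le_rfl ?_⟩
    simp only [multiplyStep, Prog.exec, inc, eval]
    refine ⟨hm, by simp [h0'], by simp [h1], by simp [h2], by simp [h3], ?_, by simp [h4],
      by simp [h7]⟩
    rw [Function.update_of_ne (by omega), Function.update_self, h6, h7]
    ring
  · rintro s ⟨hm, h0', h1, h2, h3, h6, h4, h7⟩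
    simp [eval, h4, h0', h0]

/-- Register `6` holds the first unused power. Keys in use have smaller exponents, so after the scan
`reg 5 < reg 6` holds exactly when the value has occurred before. At the end register `6` is the
number of columns. -/
theorem wp_assignKeys {n : ℕ} {v : ℕ → ℕ} {s₀ : State} {f : ℕ} (hf : f < 4) (h : Header n s₀)
    (hv : ∀ r < n, s₀.mem (3 * n + 1 + 6 * r + f) = v r) :
    WP (assignKeys f) ((n + 1) * (n + 1)) (fun s => ∃ e, KeyInv n v s₀ e n s) s₀ := by
  refine .seq (.exec rfl (by nlinarith) ?_)
  refine WP.loop (fun i s => ∃ e, KeyInv n v s₀ e i s) (by omega) ?_ ?_ ?_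
  · simp only [Prog.exec, eval]
    exact ⟨fun _ => 0, h.congr (by simp) (by simp) (by simp), by simp, by simp, by simp, by simp,
      by simp, fun _ _ => rfl⟩
  · rintro i hi s ⟨e, hs⟩
    refine ⟨by simp [eval, hs.reg3, hs.header.reg0, hi], .seq (.exec rfl (by omega) ?_)⟩
    refine .seq ((wp_keyScan (e := e) hf hv hi ?_ (by simp [Prog.exec, eval])
      (by simp [Prog.exec, eval])).mono le_rfl ?_)
    · simp only [Prog.exec, eval]
      exact ⟨hs.header.congr (by simp) (by simp) (by simp), by simp [hs.reg3],
        by simp [hs.reg6], hs.lt, hs.eq, hs.key, hs.frame⟩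
    clear hs s
    rintro s ⟨hs, h5⟩
    refine .seq (.exec rfl (by omega) ?_)
    simp only [Prog.exec, eval, eval_field, hs.reg3, hs.header.reg1]
    have hframe : ∀ x, ∀ a, (∀ q < n, a ≠ 3 * n + 1 + 6 * q + 4) →
        Function.update s.mem (3 * n + 1 + 6 * i + 4) x a = s₀.mem a := by
      intro x a ha
      rw [Function.update_of_ne (ha i hi), hs.frame a ha]
    have hkey : ∀ q < i, ∀ x, Function.update s.mem (3 * n + 1 + 6 * i + 4) x
        (3 * n + 1 + 6 * q + 4) = (n + 1) ^ e q := by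
      intro q hq x
      rw [Function.update_of_ne (by omega), hs.key q hq]
    refine .seq (.cond (by omega) (fun hlt => .exec rfl (by omega) (.exec rfl (by omega) ?_))
      fun hlt => ?_)
    · obtain ⟨q, hq, hvq, h5q⟩ : ∃ q < i, v q = v i ∧ s.reg 5 = (n + 1) ^ e q := by
        rcases h5 with h5 | h5
        · simp [eval, h5.2] at hlt
        · exact h5
      have himage : (range (i + 1)).image v = (range i).image v := by
        rw [range_add_one, image_insert, insert_eq_of_mem]
        exact mem_image.2 ⟨q, mem_range.2 hq, hvq⟩
      simp only [Prog.exec, inc, eval]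
      refine ⟨Function.update e i (e q), hs.header.congr (by simp) (by simp) (by simp),
        by simp [hs.reg3], by simp [himage, hs.reg6], ?_, ?_, ?_, hframe _⟩
      · rw [himage]
        intro r hr
        rcases Nat.lt_succ_iff_lt_or_eq.1 hr with hr | rfl
        · rw [Function.update_of_ne hr.ne]
          exact hs.lt r hr
        · rw [Function.update_self]
          exact hs.lt q hq
      · intro r hr r' hr'
        rcases Nat.lt_succ_iff_lt_or_eq.1 hr with hr | rfl <;>
          rcases Nat.lt_succ_iff_lt_or_eq.1 hr' with hr' | rfl
        · rw [Function.update_of_ne hr.ne, Function.update_of_ne hr'.ne]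
          exact hs.eq r hr r' hr'
        · rw [Function.update_of_ne hr.ne, Function.update_self, ← hvq]
          exact hs.eq r hr q hq
        · rw [Function.update_of_ne hr'.ne, Function.update_self, ← hvq]
          exact hs.eq q hq r' hr'
        · exact fun _ => rfl
      · intro r hr
        rcases Nat.lt_succ_iff_lt_or_eq.1 hr with hr | rfl
        · rw [Function.update_of_ne hr.ne]
          exact hkey r hr _
        · simp only [Function.update_self, h5q]
    · have hnew : v i ∉ (range i).image v ∧ s.reg 5 = s.reg 6 := by
        rcases h5 with h5 | ⟨q, hq, -, h5⟩
        · exact h5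
        · refine absurd ?_ hlt
          simp only [eval, h5, hs.reg6]
          exact Nat.pow_lt_pow_right (by omega) (hs.lt q hq)
      have hcard : #((range (i + 1)).image v) = #((range i).image v) + 1 := by
        rw [range_add_one, image_insert, card_insert_of_notMem hnew.1]
      refine .seq (.exec rfl (by omega) ((wp_multiply (n := n) ?_ ?_ ?_).mono le_rfl ?_))
      · simp [Prog.exec, eval, hs.header.reg0]
      · simp [Prog.exec, eval]
      · simp [Prog.exec, eval]
      rintro s' ⟨hm, h0, h1, h2, h3, h6⟩
      refine .exec rfl (by omega) ?_
      simp [Prog.exec, eval] at hm h0 h1 h2 h3 h6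
      simp only [Prog.exec, inc, eval]
      refine ⟨Function.update e i #((range i).image v),
        hs.header.congr (by simp [h0]) (by simp [h1]) (by simp [h2]), by simp [h3, hs.reg3],
        by simp [hcard, h6, hs.reg6, pow_succ], ?_, ?_, ?_, fun a ha => ?_⟩
      · rw [hcard]
        intro r hr
        rcases Nat.lt_succ_iff_lt_or_eq.1 hr with hr | rfl
        · rw [Function.update_of_ne hr.ne]
          exact (hs.lt r hr).trans (Nat.lt_succ_self _)
        · rw [Function.update_self]
          exact Nat.lt_succ_self _
      · intro r hr r' hr'
        rcases Nat.lt_succ_iff_lt_or_eq.1 hr with hr | rfl <;>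
          rcases Nat.lt_succ_iff_lt_or_eq.1 hr' with hr' | rfl
        · rw [Function.update_of_ne hr.ne, Function.update_of_ne hr'.ne]
          exact hs.eq r hr r' hr'
        · rw [Function.update_of_ne hr.ne, Function.update_self]
          exact fun h => absurd h (hs.lt r hr).ne
        · rw [Function.update_of_ne hr'.ne, Function.update_self]
          exact fun h => absurd h (hs.lt r' hr').ne'
        · exact fun _ => rfl
      · intro r hr
        rw [hm]
        rcases Nat.lt_succ_iff_lt_or_eq.1 hr with hr | rfl
        · rw [Function.update_of_ne hr.ne]
          exact hkey r hr _
        · simp only [Function.update_self, hnew.2, hs.reg6]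
      · rw [hm]
        exact hframe _ a ha
  · rintro s ⟨e, hs⟩
    simp [eval, hs.reg3, hs.header.reg0]

/-! ### The program: the table -/

/-- Loads the entries of the previous row that are needed for the next entry. -/
def loadEntries : Prog :=
  set 18 (load (reg 9)) ;; set 19 (load (add (reg 9) (const 1))) ;;
  set 20 (load (add (reg 9) (const 2))) ;;
  cond (reg 4) (reg 14) (set 21 (const 0) ;; set 22 (const 0) ;; set 23 (const 0))
    (set 21 (load (sub (reg 9) (reg 13))) ;;
     set 22 (load (add (sub (reg 9) (reg 13)) (const 1))) ;;
     set 23 (load (add (sub (reg 9) (reg 13)) (const 2))))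

def takeJob : Prog :=
  set 24 (const 2) ;; set 25 (add (reg 22) (reg 10)) ;; set 26 (add (reg 23) (reg 12))

/-- Computes `Entry.step`. -/
def computeEntry : Prog :=
  cond (const 0) (reg 18) (set 24 (const 1) ;; set 25 (reg 19) ;; set 26 (reg 20))
    (set 24 (const 0) ;; set 25 (const 0) ;; set 26 (const 0)) ;;
  cond (const 0) (reg 21)
    (cond (reg 11) (add (reg 22) (reg 10)) skip
      (cond (const 0) (reg 18)
        (cond (add (add (reg 22) (reg 10)) (reg 20)) (add (reg 19) (add (reg 23) (reg 12)))
          takeJob skip)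
        takeJob))
    skip

def storeEntry : Prog :=
  store (add (reg 9) (reg 8)) (reg 24) ;;
  store (add (add (reg 9) (reg 8)) (const 1)) (reg 25) ;;
  store (add (add (reg 9) (reg 8)) (const 2)) (reg 26) ;;
  inc 4 ;; set 9 (add (reg 9) (const 3))

/-- Row `0` needs a single write, since only the empty set is recorded there. Register `8` is the
length of a row in cells and register `13` the offset of the candidate, three cells per entry. Rows
are contiguous, so register `9` just keeps advancing. -/
def fillTable : Prog :=
  (store (reg 2) (const 1) ;; set 8 (mul3 (reg 6)) ;; set 9 (reg 2) ;; set 3 (const 0)) ;;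
  loop (reg 3) (reg 0)
    ((set 10 (load (field (reg 3) 0)) ;; set 11 (load (field (reg 3) 1)) ;;
      set 12 (load (field (reg 3) 2)) ;; set 14 (load (field (reg 3) 4)) ;;
      set 13 (mul3 (reg 14)) ;; set 4 (const 0)) ;;
     loop (reg 4) (reg 6) (loadEntries ;; computeEntry ;; storeEntry) ;;
     inc 3)

/-- The memory holds the entry `e` at address `a`. -/
def EntryAt (m : ℕ → ℕ) (a : ℕ) (e : Entry) : Prop :=
  m a = e.tag ∧ m (a + 1) = e.time ∧ m (a + 2) = e.weight

theorem exec_loadEntries {s : State} {o c : Entry} (ho : EntryAt s.mem (s.reg 9) o)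
    (hc : c = ⟨0, 0, 0⟩ ∧ s.reg 4 < s.reg 14 ∨
      EntryAt s.mem (s.reg 9 - s.reg 13) c ∧ s.reg 14 ≤ s.reg 4) :
    let s' := loadEntries.exec s
    s'.mem = s.mem ∧ (∀ r < 18, s'.reg r = s.reg r) ∧
      s'.reg 18 = o.tag ∧ s'.reg 19 = o.time ∧ s'.reg 20 = o.weight ∧
      s'.reg 21 = c.tag ∧ s'.reg 22 = c.time ∧ s'.reg 23 = c.weight := by
  obtain ⟨o1, o2, o3⟩ := ho
  rcases hc with ⟨rfl, hlt⟩ | ⟨⟨c1, c2, c3⟩, hle⟩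
  · have hr : ∀ r < 18, (loadEntries.exec s).reg r = s.reg r := by
      intro r hr
      simp (disch := omega) [loadEntries, Prog.exec, eval, hlt, Function.update_of_ne]
    refine ⟨?_, hr, ?_⟩ <;> simp [loadEntries, Prog.exec, eval, hlt, o1, o2, o3]
  · have hr : ∀ r < 18, (loadEntries.exec s).reg r = s.reg r := by
      intro r hr
      simp (disch := omega) [loadEntries, Prog.exec, eval, not_lt.2 hle, Function.update_of_ne]
    refine ⟨?_, hr, ?_⟩ <;>
      simp [loadEntries, Prog.exec, eval, not_lt.2 hle, o1, o2, o3, c1, c2, c3]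

/-- The first conditional writes the result of leaving the job out; the nested one overwrites it
exactly under the condition of `Entry.step`. -/
theorem exec_computeEntry {s : State} {o c : Entry} (h18 : s.reg 18 = o.tag)
    (h19 : s.reg 19 = o.time) (h20 : s.reg 20 = o.weight) (h21 : s.reg 21 = c.tag)
    (h22 : s.reg 22 = c.time) (h23 : s.reg 23 = c.weight) :
    let s' := computeEntry.exec s
    let e := Entry.step (s.reg 10) (s.reg 11) (s.reg 12) o c
    s'.mem = s.mem ∧ (∀ r < 18, s'.reg r = s.reg r) ∧
      s'.reg 24 = e.tag ∧ s'.reg 25 = e.time ∧ s'.reg 26 = e.weight := by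
  dsimp only
  -- the copied entry
  set s₁ := (cond (const 0) (reg 18) (set 24 (const 1) ;; set 25 (reg 19) ;; set 26 (reg 20))
    (set 24 (const 0) ;; set 25 (const 0) ;; set 26 (const 0))).exec s with hs₁
  have h₁ : s₁.mem = s.mem ∧ (∀ r < 24, s₁.reg r = s.reg r) ∧
      s₁.reg 24 = (if 0 < o.tag then 1 else 0) ∧
      s₁.reg 25 = (if 0 < o.tag then o.time else 0) ∧
      s₁.reg 26 = (if 0 < o.tag then o.weight else 0) := by
    have hr : ∀ r < 24, s₁.reg r = s.reg r := by
      intro r hr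
      by_cases h : 0 < s.reg 18 <;>
        simp (disch := omega) only [hs₁, Prog.exec, eval, h, if_true, if_false,
          Function.update_of_ne]
    refine ⟨?_, hr, ?_⟩
    · simp only [hs₁, Prog.exec]
      split_ifs <;> rfl
    · simp only [hs₁, Prog.exec, eval, h18]
      split_ifs <;> simp [h19, h20]
  obtain ⟨hm, hr, h24, h25, h26⟩ := h₁
  have hexec : computeEntry.exec s = (cond (const 0) (reg 21)
    (cond (reg 11) (add (reg 22) (reg 10)) skip
      (cond (const 0) (reg 18)
        (cond (add (add (reg 22) (reg 10)) (reg 20)) (add (reg 19) (add (reg 23) (reg 12)))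
          takeJob skip)
        takeJob))
    skip).exec s₁ := rfl
  rw [hexec]
  clear_value s₁
  have htake : ∀ r < 24, (takeJob.exec s₁).reg r = s₁.reg r := by
    intro r hr
    simp (disch := omega) only [takeJob, Prog.exec, Function.update_of_ne]
  have hcopy : (takeJob.exec s₁).mem = s₁.mem := rfl
  simp only [Prog.exec, eval, hr _ (show 10 < 24 by omega), hr _ (show 11 < 24 by omega),
    hr _ (show 12 < 24 by omega), hr _ (show 18 < 24 by omega), hr _ (show 19 < 24 by omega),
    hr _ (show 20 < 24 by omega), hr _ (show 21 < 24 by omega), hr _ (show 22 < 24 by omega),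
    hr _ (show 23 < 24 by omega), h18, h19, h20, h21, h22, h23]
  by_cases hP : 0 < c.tag ∧ c.time + s.reg 10 ≤ s.reg 11 ∧
      (o.tag = 0 ∨ c.time + s.reg 10 + o.weight < o.time + (c.weight + s.reg 12))
  · have : ∀ a b : State, (if 0 < c.tag then if s.reg 11 < c.time + s.reg 10 then a else
        if 0 < o.tag then if c.time + s.reg 10 + o.weight < o.time + (c.weight + s.reg 12) then b
          else a else b else a) = b := by
      intro a b
      split_ifs <;> first | rfl | omega
    rw [this, Entry.step, if_pos hP]
    refine ⟨hm, fun r h => (htake r (by omega)).trans (hr r (by omega)), ?_⟩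
    simp [takeJob, Prog.exec, eval, hr, h22, h23]
  · have : ∀ a b : State, (if 0 < c.tag then if s.reg 11 < c.time + s.reg 10 then a else
        if 0 < o.tag then if c.time + s.reg 10 + o.weight < o.time + (c.weight + s.reg 12) then b
          else a else b else a) = a := by
      intro a b
      split_ifs <;> first | rfl | omega
    rw [this, Entry.step, if_neg hP]
    refine ⟨hm, fun r h => hr r (by omega), ?_⟩
    rw [h24, h25, h26]
    split_ifs <;> exact ⟨rfl, rfl, rfl⟩

theorem exec_storeEntry (s : State) (e : Entry) (h24 : s.reg 24 = e.tag) (h25 : s.reg 25 = e.time)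
    (h26 : s.reg 26 = e.weight) :
    let s' := storeEntry.exec s
    (∀ a, a < s.reg 9 + s.reg 8 ∨ s.reg 9 + s.reg 8 + 3 ≤ a → s'.mem a = s.mem a) ∧
      EntryAt s'.mem (s.reg 9 + s.reg 8) e ∧ (∀ r < 18, r ≠ 4 → r ≠ 9 → s'.reg r = s.reg r) ∧
      s'.reg 4 = s.reg 4 + 1 ∧ s'.reg 9 = s.reg 9 + 3 := by
  refine ⟨fun a ha => ?_, ?_, fun r hr h4 h9 => ?_, ?_⟩
  · simp (disch := omega) only [storeEntry, Prog.exec, inc, eval, Function.update_of_ne]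
  · unfold EntryAt
    simp (disch := omega) only [storeEntry, Prog.exec, inc, eval, Function.update_of_ne,
      Function.update_self, h24, h25, h26, and_self]
  · simp (disch := omega) only [storeEntry, Prog.exec, inc, Function.update_of_ne]
  · simp [storeEntry, Prog.exec, inc, eval]

/-- The part of the state that no phase after the computation of the keys changes. -/
structure Ready (n : ℕ) (p d w a κ : ℕ → ℕ) (N : ℕ) (s : State) : Prop where
  records : Records n p d w a s
  key : ∀ r < n, s.mem (3 * n + 1 + 6 * r + 4) = κ r
  reg6 : s.reg 6 = N

theorem Ready.congr {n N : ℕ} {p d w a κ : ℕ → ℕ} {s s' : State} (h : Ready n p d w a κ N s)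
    (h' : Header n s') (h6 : s'.reg 6 = s.reg 6)
    (hmem : ∀ r < n, ∀ f < 5, s'.mem (3 * n + 1 + 6 * r + f) = s.mem (3 * n + 1 + 6 * r + f)) :
    Ready n p d w a κ N s' :=
  ⟨h.records.congr h' fun r hr f hf => hmem r hr f (by omega),
    fun r hr => (hmem r hr 4 (by omega)).trans (h.key r hr), h6.trans h.reg6⟩

/-- The first `M` entries of the table, which is stored row by row, are correct. -/
def TableUpTo (n : ℕ) (p d w κ : ℕ → ℕ) (N M : ℕ) (m : ℕ → ℕ) : Prop :=
  ∀ k < M, EntryAt m (9 * n + 1 + 3 * k) (table p d w κ (k / N) (k % N))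

/-- Register `9` points to the entry being read, one row behind the entry to be written. When the
last row is complete, it points to the start of that row. -/
structure TableInv (n : ℕ) (p d w a κ : ℕ → ℕ) (N r x : ℕ) (s : State) : Prop where
  ready : Ready n p d w a κ N s
  flag : ∀ q < n, s.mem (3 * n + 1 + 6 * q + 5) = 0
  reg3 : s.reg 3 = r
  reg8 : s.reg 8 = 3 * N
  reg9 : s.reg 9 = 9 * n + 1 + 3 * (r * N + x)
  table : TableUpTo n p d w κ N ((r + 1) * N + x) s.mem

theorem wp_fillEntry {n N r x : ℕ} {p d w a κ : ℕ → ℕ} {s : State} (hx : x < N)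
    (h : TableInv n p d w a κ N r x s) (h4 : s.reg 4 = x) (h10 : s.reg 10 = p r)
    (h11 : s.reg 11 = d r) (h12 : s.reg 12 = w r) (h13 : s.reg 13 = 3 * κ r)
    (h14 : s.reg 14 = κ r) :
    WP (loadEntries ;; computeEntry ;; storeEntry) 1
      (fun s' => TableInv n p d w a κ N r (x + 1) s' ∧ s'.reg 4 = x + 1 ∧
        ∀ q < 18, 10 ≤ q → s'.reg q = s.reg q) s := by
  have hN : 0 < N := by omega
  have hrow : (r + 1) * N = r * N + N := by ring
  have hentry : ∀ y < N, ∀ q ≤ r, q * N + y < (r + 1) * N + x →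
      EntryAt s.mem (9 * n + 1 + 3 * (q * N + y)) (TardyJobs.table p d w κ q y) := by
    intro y hy q hq hlt
    have := h.table _ hlt
    rwa [Nat.mul_comm q N, Nat.mul_add_div hN, Nat.div_eq_of_lt hy, Nat.mul_add_mod,
      Nat.mod_eq_of_lt hy, Nat.add_zero, Nat.mul_comm N q] at this
  refine .exec rfl le_rfl ?_
  simp only [Prog.exec]
  obtain ⟨hm₁, hr₁, h18, h19, h20, h21, h22, h23⟩ := exec_loadEntries (s := s)
    (o := TardyJobs.table p d w κ r x)
    (c := if κ r ≤ x then TardyJobs.table p d w κ r (x - κ r) else ⟨0, 0, 0⟩)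
    (by rw [h.reg9]; exact hentry x hx r le_rfl (by omega)) (by
      rw [h.reg9, h4, h13, h14]
      split_ifs with hκ
      · refine .inr ⟨?_, hκ⟩
        have := hentry (x - κ r) (by omega) r le_rfl (by omega)
        rwa [show 9 * n + 1 + 3 * (r * N + x) - 3 * κ r = 9 * n + 1 + 3 * (r * N + (x - κ r)) by
          omega]
      · exact .inl ⟨rfl, by omega⟩)
  obtain ⟨hm₂, hr₂, h24, h25, h26⟩ := exec_computeEntry h18 h19 h20 h21 h22 h23
  have hr₂' : ∀ q < 18, (computeEntry.exec (loadEntries.exec s)).reg q = s.reg q :=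
    fun q hq => (hr₂ q hq).trans (hr₁ q hq)
  rw [hr₁ 10 (by omega), hr₁ 11 (by omega), hr₁ 12 (by omega), h10, h11, h12] at h24 h25 h26
  obtain ⟨hm₃, he, hr₃, h4', h9'⟩ := exec_storeEntry _ _ h24 h25 h26
  rw [hr₂' 9 (by omega), hr₂' 8 (by omega), h.reg8, h.reg9,
    show 9 * n + 1 + 3 * (r * N + x) + 3 * N = 9 * n + 1 + 3 * ((r + 1) * N + x) by
      rw [hrow]; ring] at hm₃ he
  rw [hm₂, hm₁] at hm₃
  rw [hr₂' 4 (by omega), h4] at h4'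
  rw [hr₂' 9 (by omega), h.reg9] at h9'
  have hr₄ : ∀ q < 18, q ≠ 4 → q ≠ 9 →
      (storeEntry.exec (computeEntry.exec (loadEntries.exec s))).reg q = s.reg q :=
    fun q hq h4 h9 => (hr₃ q hq h4 h9).trans (hr₂' q hq)
  generalize storeEntry.exec (computeEntry.exec (loadEntries.exec s)) = s' at *
  refine ⟨⟨h.ready.congr (h.ready.records.header.congr (hr₄ _ (by omega) (by omega) (by omega))
    (hr₄ _ (by omega) (by omega) (by omega)) (hr₄ _ (by omega) (by omega) (by omega)))
    (hr₄ _ (by omega) (by omega) (by omega)) fun q hq f hf => hm₃ _ (by omega),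
    fun q hq => (hm₃ _ (by omega)).trans (h.flag q hq),
    (hr₄ _ (by omega) (by omega) (by omega)).trans h.reg3,
    (hr₄ _ (by omega) (by omega) (by omega)).trans h.reg8,
    h9', ?_⟩, h4', fun q hq hq' => hr₄ q hq (by omega) (by omega)⟩
  intro k hk
  have hk' : k < (r + 1) * N + x ∨ k = (r + 1) * N + x := by omega
  rcases hk' with hk | rfl
  · obtain ⟨e1, e2, e3⟩ := h.table k hk
    exact ⟨(hm₃ _ (by omega)).trans e1, (hm₃ _ (by omega)).trans e2, (hm₃ _ (by omega)).trans e3⟩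
  · have hdiv : ((r + 1) * N + x) / N = r + 1 := by
      rw [Nat.mul_comm, Nat.mul_add_div hN, Nat.div_eq_of_lt hx, Nat.add_zero]
    have hmod : ((r + 1) * N + x) % N = x := by
      rw [Nat.mul_comm, Nat.mul_add_mod, Nat.mod_eq_of_lt hx]
    rw [hdiv, hmod, TardyJobs.table]
    exact he

theorem wp_fillTable {n N : ℕ} {p d w a κ : ℕ → ℕ} {s : State} (hN : 0 < N)
    (h : Ready n p d w a κ N s) (hflag : ∀ q < n, s.mem (3 * n + 1 + 6 * q + 5) = 0)
    (hfree : ∀ a, 9 * n + 1 ≤ a → s.mem a = 0) :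
    WP fillTable ((N + 1) * (n + 1)) (TableInv n p d w a κ N n 0) s := by
  refine .seq (.exec rfl (by nlinarith) ?_)
  refine WP.loop (fun r => TableInv n p d w a κ N r 0) (by omega) ?_ ?_ ?_
  · simp only [Prog.exec, eval, eval_mul3, h.records.header.reg2]
    refine ⟨h.congr (h.records.header.congr (by simp) (by simp) (by simp)) (by simp)
      fun r hr f hf => ?_, fun q hq => ?_, by simp, by simp [h.reg6],
      by simp [h.records.header.reg2], fun k hk => ?_⟩
    · simp (disch := omega) only [Function.update_of_ne]
    · simp (disch := omega) only [Function.update_of_ne]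
      exact hflag q hq
    · have hk' : k < N := by omega
      rw [Nat.div_eq_of_lt hk', Nat.mod_eq_of_lt hk', table]
      unfold EntryAt
      split_ifs with hk0
      · subst hk0
        refine ⟨by simp, ?_, ?_⟩ <;> simp (disch := omega) only [Function.update_of_ne]
        exacts [hfree _ (by omega), hfree _ (by omega)]
      · refine ⟨?_, ?_, ?_⟩ <;> simp (disch := omega) only [Function.update_of_ne]
        exacts [hfree _ (by omega), hfree _ (by omega), hfree _ (by omega)]
  · intro r hr s hs
    have hrec := hs.ready.records
    have h1 := hrec.header.reg1
    have hp := hrec.p r hr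
    have hd := hrec.d r hr
    have hw := hrec.w r hr
    have hκ := hs.ready.key r hr
    refine ⟨by simp [eval, hs.reg3, hrec.header.reg0, hr], .seq (.exec rfl (by omega) ?_)⟩
    have := WP.loop (a := reg 4) (b := reg 6) (P := loadEntries ;; computeEntry ;; storeEntry)
      (c := 1) (N := N) (s := Prog.exec (set 10 (load (field (reg 3) 0)) ;;
        set 11 (load (field (reg 3) 1)) ;; set 12 (load (field (reg 3) 2)) ;;
        set 14 (load (field (reg 3) 4)) ;; set 13 (mul3 (reg 14)) ;; set 4 (const 0)) s)
      (fun x s' => TableInv n p d w a κ N r x s' ∧ s'.reg 4 = x ∧ s'.reg 10 = p r ∧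
        s'.reg 11 = d r ∧ s'.reg 12 = w r ∧ s'.reg 13 = 3 * κ r ∧ s'.reg 14 = κ r)
      le_rfl ?_ ?_ ?_
    · refine .seq (this.mono (by omega) ?_)
      rintro s' ⟨hs', -⟩
      refine .exec rfl (by omega) ?_
      simp only [inc, Prog.exec, eval]
      exact ⟨hs'.ready.congr (hs'.ready.records.header.congr (by simp) (by simp) (by simp))
        (by simp) fun _ _ _ _ => rfl, hs'.flag, by simp [hs'.reg3], by simp [hs'.reg8],
        by simp [hs'.reg9]; ring, by have := hs'.table; rwa [← Nat.succ_mul] at this⟩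
    · simp only [Prog.exec, eval, eval_field, eval_mul3]
      refine ⟨⟨hs.ready.congr (hrec.header.congr (by simp) (by simp) (by simp))
        (by simp) fun _ _ _ _ => rfl, hs.flag, by simp [hs.reg3], by simp [hs.reg8],
        by simp [hs.reg9], hs.table⟩, ?_⟩
      simp [hs.reg3, h1, hp, hd, hw, hκ]
    · rintro x hx s' ⟨hs', h4, h10, h11, h12, h13, h14⟩
      refine ⟨by simpa [eval, h4, hs'.ready.reg6] using hx,
        (wp_fillEntry hx hs' h4 h10 h11 h12 h13 h14).mono le_rfl ?_⟩
      rintro s'' ⟨hs'', h4', hr⟩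
      exact ⟨hs'', h4', (hr _ (by omega) (by omega)).trans h10,
        (hr _ (by omega) (by omega)).trans h11, (hr _ (by omega) (by omega)).trans h12,
        (hr _ (by omega) (by omega)).trans h13, (hr _ (by omega) (by omega)).trans h14⟩
    · rintro s' ⟨hs', h4, -⟩
      simp [eval, h4, hs'.ready.reg6]
  · intro s hs
    simp [eval, hs.reg3, hs.ready.records.header.reg0]

/-! ### The program: reading off a schedule -/

def findBest : Prog :=
  (set 15 (reg 9) ;; set 4 (const 0)) ;;
  loop (reg 4) (reg 6)
    (cond (load (add (reg 15) (const 2))) (load (add (reg 9) (const 2))) (set 15 (reg 9)) skip ;;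
     set 9 (add (reg 9) (const 3)) ;; inc 4)

/-- Tag `2` means that the job was taken: the predecessor lies one row back and `κ` columns to the
left. Otherwise it is in the same column. -/
def backtrackStep : Prog :=
  set 3 (sub (reg 3) (const 1)) ;;
  cond (const 1) (load (reg 15))
    (store (field (reg 3) 5) (const 1) ;;
     set 15 (sub (reg 15) (add (reg 8) (mul3 (load (field (reg 3) 4))))))
    (set 15 (sub (reg 15) (reg 8)))

def backtrack : Prog := set 3 (reg 0) ;; loop (const 0) (reg 3) backtrackStep

/-- Register `16` is the next free position at the front and register `17` the one just past the
next free position at the back. The output overwrites only cells below `n`, so the sorted list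
survives. -/
def outputStep : Prog :=
  cond (const 0) (load (field (reg 3) 5))
    (store (reg 16) (load (field (reg 3) 3)) ;; inc 16)
    (set 17 (sub (reg 17) (const 1)) ;; store (reg 17) (load (field (reg 3) 3))) ;;
  inc 3

def output : Prog :=
  (set 16 (const 0) ;; set 17 (reg 0) ;; set 3 (const 0)) ;; loop (reg 3) (reg 0) outputStep

theorem TableUpTo.entryAt {n N M : ℕ} {p d w κ m : ℕ → ℕ} (h : TableUpTo n p d w κ N M m)
    {r x : ℕ} (hx : x < N) (hM : r * N + x < M) :
    EntryAt m (9 * n + 1 + 3 * (r * N + x)) (table p d w κ r x) := by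
  have := h _ hM
  rwa [Nat.mul_comm r N, Nat.mul_add_div (by omega), Nat.div_eq_of_lt hx, Nat.mul_add_mod,
    Nat.mod_eq_of_lt hx, Nat.add_zero, Nat.mul_comm N r] at this

/-- The state after the table has been filled. -/
structure Filled (n : ℕ) (p d w a κ : ℕ → ℕ) (N : ℕ) (s : State) : Prop where
  ready : Ready n p d w a κ N s
  reg8 : s.reg 8 = 3 * N
  table : TableUpTo n p d w κ N ((n + 1) * N) s.mem

/-- `tag` replaces a test of tags: column `0` is abandoned only for a strictly larger, hence
positive, weight, and entries that record nothing have weight `0`. -/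
structure BestInv (n : ℕ) (p d w a κ : ℕ → ℕ) (N b x : ℕ) (s : State) : Prop where
  filled : Filled n p d w a κ N s
  flag : ∀ q < n, s.mem (3 * n + 1 + 6 * q + 5) = 0
  reg4 : s.reg 4 = x
  reg9 : s.reg 9 = 9 * n + 1 + 3 * (n * N + x)
  reg15 : s.reg 15 = 9 * n + 1 + 3 * (n * N + b)
  lt : b < N
  best : ∀ y < x, (TardyJobs.table p d w κ n y).weight ≤ (TardyJobs.table p d w κ n b).weight
  tag : b = 0 ∨ 0 < (TardyJobs.table p d w κ n b).weight

theorem wp_findBest {n N : ℕ} {p d w a κ : ℕ → ℕ} {s : State} (hN : 0 < N)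
    (h : TableInv n p d w a κ N n 0 s) :
    WP findBest (N + 1) (fun s' => ∃ b, BestInv n p d w a κ N b N s') s := by
  refine .seq (.exec rfl (by omega) ?_)
  have := WP.loop (a := reg 4) (b := reg 6)
    (P := cond (load (add (reg 15) (const 2))) (load (add (reg 9) (const 2))) (set 15 (reg 9)) skip
      ;; set 9 (add (reg 9) (const 3)) ;; inc 4)
    (c := 1) (N := N) (s := Prog.exec (set 15 (reg 9) ;; set 4 (const 0)) s)
    (fun x s' => ∃ b, BestInv n p d w a κ N b x s') le_rfl ?_ ?_ ?_
  · exact this.mono (by omega) fun _ h => h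
  · simp only [Prog.exec, eval]
    exact ⟨0, ⟨h.ready.congr (h.ready.records.header.congr (by simp) (by simp) (by simp))
      (by simp) fun _ _ _ _ => rfl, by simp [h.reg8], h.table⟩, h.flag, by simp, by simp [h.reg9],
      by simp [h.reg9], hN, by simp, .inl rfl⟩
  · rintro x hx s' ⟨b, hs⟩
    have hrow : (n + 1) * N = n * N + N := by ring
    refine ⟨by simpa [eval, hs.reg4, hs.filled.ready.reg6] using hx, .exec rfl le_rfl ?_⟩
    have hb := (hs.filled.table.entryAt hs.lt (r := n) (by have := hs.lt; omega)).2.2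
    have hx' := (hs.filled.table.entryAt hx (r := n) (by omega)).2.2
    simp only [inc, Prog.exec, eval, hs.reg9, hs.reg15, hb, hx']
    have hready : ∀ {s'' : State}, s''.mem = s'.mem → (∀ r < 9, r ≠ 4 → s''.reg r = s'.reg r) →
        Filled n p d w a κ N s'' := by
      intro s'' hm hr
      refine ⟨hs.filled.ready.congr (hs.filled.ready.records.header.congr
        (hr _ (by omega) (by omega)) (hr _ (by omega) (by omega)) (hr _ (by omega) (by omega)))
        (hr _ (by omega) (by omega)) fun r _ f _ => by rw [hm],
        (hr _ (by omega) (by omega)).trans hs.filled.reg8, hm ▸ hs.filled.table⟩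
    by_cases hlt : (TardyJobs.table p d w κ n b).weight < (TardyJobs.table p d w κ n x).weight
    · rw [if_pos hlt]
      refine ⟨x, hready rfl fun r hr hr4 => ?_, hs.flag, by simp [hs.reg4],
        by simp [hs.reg9]; ring, by simp, hx, fun y hy => ?_, .inr (by omega)⟩
      · simp (disch := omega) only [Function.update_of_ne]
      · rcases Nat.lt_succ_iff_lt_or_eq.1 hy with hy | rfl
        exacts [(hs.best y hy).trans hlt.le, le_rfl]
    · rw [if_neg hlt]
      refine ⟨b, hready rfl fun r hr hr4 => ?_, hs.flag, by simp [hs.reg4],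
        by simp [hs.reg9]; ring, by simp [hs.reg15], hs.lt, fun y hy => ?_, hs.tag⟩
      · simp (disch := omega) only [Function.update_of_ne]
      · rcases Nat.lt_succ_iff_lt_or_eq.1 hy with hy | rfl
        exacts [hs.best y hy, not_lt.1 hlt]
  · rintro s' ⟨b, hs⟩
    simp [eval, hs.reg4, hs.filled.ready.reg6]

theorem le_of_one_lt_tag {p d w κ : ℕ → ℕ} {r x : ℕ}
    (h : 1 < (table p d w κ (r + 1) x).tag) : κ r ≤ x := by
  by_contra hκ
  rw [table, if_neg hκ, Entry.step] at h
  split_ifs at h <;> simp_all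

/-- During the backtracking, the flags of the jobs from the `r`-th one on tell whether they belong
to `T`, and the current entry of the table records the rest of `T`. -/
structure BacktrackInv (n : ℕ) (p d w a κ : ℕ → ℕ) (N : ℕ) (T : Finset ℕ) (r x : ℕ)
    (s : State) : Prop where
  filled : Filled n p d w a κ N s
  reg3 : s.reg 3 = r
  le : r ≤ n
  reg15 : s.reg 15 = 9 * n + 1 + 3 * (r * N + x)
  lt : x < N
  flag : ∀ q < n, s.mem (3 * n + 1 + 6 * q + 5) = if r ≤ q ∧ q ∈ T then 1 else 0
  trace : ∀ q < r, q ∈ T ↔ q ∈ TardyJobs.trace p d w κ r x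

theorem wp_backtrackStep {n N r x : ℕ} {p d w a κ : ℕ → ℕ} {T : Finset ℕ} {s : State}
    (h : BacktrackInv n p d w a κ N T (r + 1) x s) :
    WP backtrackStep 1 (fun s' => ∃ x, BacktrackInv n p d w a κ N T r x s') s := by
  refine .exec rfl le_rfl ?_
  have hr := h.le
  have hx := h.lt
  have hrow : (r + 1) * N = r * N + N := by ring
  have hmul : (r + 1 + 1) * N ≤ (n + 1) * N := Nat.mul_le_mul_right _ (by omega)
  have hrow' : (r + 1 + 1) * N = r * N + N + N := by ring
  have hent := (h.filled.table.entryAt hx (r := r + 1) (by omega)).1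
  have hready := h.filled.ready
  have h1 := hready.records.header.reg1
  have hκ := hready.key r (by omega)
  have htr := h.trace
  rw [TardyJobs.trace] at htr
  have hnr : ∀ y, r ∉ TardyJobs.trace p d w κ r y := fun y hy => by
    simpa using trace_subset _ _ hy
  have h15 := h.reg15
  simp [backtrackStep, Prog.exec, eval, h.reg3, h15, hent, h1, hκ, h.filled.reg8]
  by_cases htag : 1 < (TardyJobs.table p d w κ (r + 1) x).tag
  · have hle := le_of_one_lt_tag htag
    rw [if_pos htag] at htr
    rw [if_pos htag]
    refine ⟨x - κ r, ⟨hready.congr (hready.records.header.congr (by simp) (by simp) (by simp))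
      (by simp) fun q hq f hf => ?_, by simp [h.filled.reg8], fun k hk => ?_⟩, by simp, by omega,
      ?_, by omega, fun q hq => ?_, fun q hq => ?_⟩
    · simp (disch := omega) only [Function.update_of_ne]
    · unfold EntryAt
      simp (disch := omega) only [Function.update_of_ne]
      exact h.filled.table k hk
    · simp only [Function.update_self]
      omega
    · rcases eq_or_ne q r with rfl | hqr
      · simp [htr q (by omega)]
      · simp (disch := omega) only [Function.update_of_ne]
        rw [h.flag q hq]
        congr 2
        exact propext ⟨fun h => by omega, fun h => by omega⟩
    · rw [htr q (by omega), mem_insert, or_iff_right (by omega)]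
  · rw [if_neg htag] at htr
    rw [if_neg htag]
    refine ⟨x, ⟨hready.congr (hready.records.header.congr (by simp) (by simp) (by simp))
      (by simp) fun q hq f hf => rfl, by simp [h.filled.reg8], h.filled.table⟩, by simp, by omega,
      ?_, by omega, fun q hq => ?_, fun q hq => htr q (by omega)⟩
    · simp only [Function.update_self]
      omega
    · dsimp only
      rw [h.flag q hq]
      -- When the job was not taken, membership of `r` in `T` is decided by a trace inside `range
      -- r`; its flag correctly remains `0`.
      have hrT : r ∉ T := fun hrT => hnr x ((htr r (by omega)).1 hrT)
      congr 1
      refine propext ⟨fun h => ⟨by omega, h.2⟩, fun h => ⟨?_, h.2⟩⟩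
      have : q ≠ r := fun hq => hrT (hq ▸ h.2)
      omega

theorem wp_backtrack {n N b : ℕ} {p d w a κ : ℕ → ℕ} {s : State}
    (h : BestInv n p d w a κ N b N s) :
    WP backtrack (n + 1)
      (fun s' => ∃ x, BacktrackInv n p d w a κ N (trace p d w κ n b) 0 x s') s := by
  have hready := h.filled.ready
  refine .seq (.exec rfl (by omega) ?_)
  have := WP.loop (a := const 0) (b := reg 3) (P := backtrackStep) (c := 1) (N := n)
    (s := Prog.exec (set 3 (reg 0)) s)
    (fun i s' => ∃ x, BacktrackInv n p d w a κ N (trace p d w κ n b) (n - i) x s') le_rfl ?_ ?_ ?_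
  · refine this.mono (by omega) ?_
    rw [Nat.sub_self]
    exact fun _ h => h
  · simp only [Prog.exec, eval]
    refine ⟨b, ⟨hready.congr (hready.records.header.congr (by simp) (by simp) (by simp))
      (by simp) fun q hq f hf => rfl, by simp [h.filled.reg8], h.filled.table⟩,
      by simp [hready.records.header.reg0], by omega, by simp [h.reg15], h.lt, fun q hq => ?_,
      fun q hq => Iff.rfl⟩
    rw [if_neg (by omega)]
    exact h.flag q hq
  · rintro i hi s' ⟨x, hs⟩
    refine ⟨by simp only [eval, hs.reg3]; omega, ?_⟩
    rw [show n - i = n - (i + 1) + 1 by omega] at hs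
    exact wp_backtrackStep hs
  · rintro s' ⟨x, hs⟩
    simp [eval, hs.reg3]

structure OutputInv (n : ℕ) (p d w a : ℕ → ℕ) (T : Finset ℕ) (r : ℕ) (s : State) : Prop where
  records : Records n p d w a s
  reg3 : s.reg 3 = r
  reg16 : s.reg 16 = #{i ∈ range r | i ∈ T}
  reg17 : s.reg 17 = n - #{i ∈ range r | i ∉ T}
  flag : ∀ q < n, s.mem (3 * n + 1 + 6 * q + 5) = if q ∈ T then 1 else 0
  out : ∀ q < r, s.mem (position T n q) = a q

theorem wp_output {n : ℕ} {p d w a : ℕ → ℕ} {T : Finset ℕ} {s : State}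
    (h : Records n p d w a s)
    (hflag : ∀ q < n, s.mem (3 * n + 1 + 6 * q + 5) = if q ∈ T then 1 else 0) :
    WP output (n + 1) (fun s' => ∀ q < n, s'.mem (position T n q) = a q) s := by
  refine .seq (.exec rfl (by omega) ?_)
  have := WP.loop (a := reg 3) (b := reg 0) (P := outputStep) (c := 1) (N := n)
    (s := Prog.exec (set 16 (const 0) ;; set 17 (reg 0) ;; set 3 (const 0)) s)
    (OutputInv n p d w a T) le_rfl ?_ ?_ ?_
  · exact this.mono (by omega) fun _ h => h.out
  · simp only [Prog.exec, eval]
    exact ⟨h.congr (h.header.congr (by simp) (by simp) (by simp)) fun _ _ _ _ => rfl,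
      by simp, by simp, by simp [h.header.reg0], hflag, by simp⟩
  · intro r hr s hs
    refine ⟨by simp [eval, hs.reg3, hs.records.header.reg0, hr], .exec rfl le_rfl ?_⟩
    have h1 := hs.records.header.reg1
    have ha := hs.records.a r hr
    have hf := hs.flag r hr
    have hpos : position T n r < n := position_lt hr
    -- Distinct positions: the new output does not overwrite earlier ones.
    have hne : ∀ q < r, position T n q ≠ position T n r := fun q hq h =>
      absurd (position_injective (by omega) hr h) (by omega)
    simp only [outputStep, inc, Prog.exec, eval, eval_field, hs.reg3, h1, hf]
    by_cases hrT : r ∈ T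
    · have hp : position T n r = s.reg 16 := by rw [hs.reg16, position, if_pos hrT]
      rw [if_pos hrT, if_pos (by omega)]
      rw [hp] at hpos hne
      have hc : #{i ∈ range (r + 1) | i ∈ T} = #{i ∈ range r | i ∈ T} + 1 := by
        rw [range_add_one, filter_insert, if_pos hrT, card_insert_of_notMem (by simp)]
      have hc' : #{i ∈ range (r + 1) | i ∉ T} = #{i ∈ range r | i ∉ T} := by
        rw [range_add_one, filter_insert, if_neg (by simpa using hrT)]
      refine ⟨hs.records.congr (hs.records.header.congr (by simp) (by simp) (by simp))
        fun q hq f hf => ?_, by simp [hs.reg3], by simp [hc, hs.reg16], by simp [hc', hs.reg17],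
        fun q hq => ?_, fun q hq => ?_⟩
      · simp (disch := omega) only [Function.update_of_ne]
      · simp (disch := omega) only [Function.update_of_ne]
        exact hs.flag q hq
      · rcases Nat.lt_succ_iff_lt_or_eq.1 hq with hq | rfl
        · have := hne q hq
          simp (disch := omega) only [Function.update_of_ne]
          exact hs.out q hq
        · simp only [hp, Function.update_self, ha]
    · have hp : position T n r = s.reg 17 - 1 := by
        rw [hs.reg17, position, if_neg hrT]
        omega
      rw [if_neg hrT, if_neg (by omega)]
      rw [hp] at hpos hne
      have hc : #{i ∈ range (r + 1) | i ∉ T} = #{i ∈ range r | i ∉ T} + 1 := by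
        rw [range_add_one, filter_insert, if_pos hrT, card_insert_of_notMem (by simp)]
      have hc' : #{i ∈ range (r + 1) | i ∈ T} = #{i ∈ range r | i ∈ T} := by
        rw [range_add_one, filter_insert, if_neg hrT]
      simp only [ne_eq, Nat.reduceEqDiff, not_false_eq_true, Function.update_of_ne, hs.reg3, h1,
        ha, Function.update_self]
      refine ⟨hs.records.congr (hs.records.header.congr (by simp) (by simp) (by simp))
        fun q hq f hf => ?_, by simp, by simp [hc', hs.reg16],
        by simp [hc, hs.reg17]; omega, fun q hq => ?_, fun q hq => ?_⟩
      · simp (disch := omega) only [Function.update_of_ne]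
      · simp (disch := omega) only [Function.update_of_ne]
        exact hs.flag q hq
      · rcases Nat.lt_succ_iff_lt_or_eq.1 hq with hq | rfl
        · have := hne q hq
          simp (disch := omega) only [Function.update_of_ne]
          exact hs.out q hq
        · simp only [hp, Function.update_self]
  · intro s hs
    simp [eval, hs.reg3, hs.records.header.reg0]

/-! ### The whole program -/

/-- The program that solves the scheduling problem by a dynamic program over the numbers of early
jobs with each processing time (`f = 0`) or with each weight (`f = 2`). -/
def solve (f : ℕ) : Prog :=
  setup ;; sortJobs ;; assignKeys f ;; fillTable ;; findBest ;; backtrack ;; output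

/-- A function on `Fin n`, continued by `0`. -/
def extend {n : ℕ} (g : Fin n → ℕ) (j : ℕ) : ℕ := if h : j < n then g ⟨j, h⟩ else 0

@[simp] theorem extend_val {n : ℕ} (g : Fin n → ℕ) (j : Fin n) : extend g j = g j := by
  simp [extend]

theorem image_extend {n : ℕ} (g : Fin n → ℕ) : (range n).image (extend g) = univ.image g := by
  ext x
  simp only [mem_image, mem_range, mem_univ, true_and]
  constructor
  · rintro ⟨j, hj, rfl⟩
    exact ⟨⟨j, hj⟩, (extend_val g ⟨j, hj⟩).symm⟩
  · rintro ⟨j, rfl⟩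
    exact ⟨j, j.2, extend_val g j⟩

theorem initialState_input {n : ℕ} (I : Instance n) (j : ℕ) (hj : j < n) :
    I.initialState.mem (3 * j + 1) = extend I.p j ∧
      I.initialState.mem (3 * j + 2) = extend I.d j ∧
      I.initialState.mem (3 * j + 3) = extend I.w j := by
  have h1 : (3 * j + 1 - 1) / 3 = j := by omega
  have h2 : (3 * j + 2 - 1) / 3 = j := by omega
  have h3 : (3 * j + 3 - 1) / 3 = j := by omega
  have h1' : (3 * j + 1 - 1) % 3 = 0 := by omega
  have h2' : (3 * j + 2 - 1) % 3 = 1 := by omega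
  have h3' : (3 * j + 3 - 1) % 3 = 2 := by omega
  simp only [Instance.initialState, extend, h1, h2, h3, h1', h2', h3', hj]
  simp

theorem initialState_free {n : ℕ} (I : Instance n) (a : ℕ) (ha : 3 * n + 1 ≤ a) :
    I.initialState.mem a = 0 := by
  have : ¬ (a - 1) / 3 < n := by omega
  simp only [Instance.initialState]
  rw [if_neg (by omega), dif_neg this]

theorem BestInv.tag_pos {n N b x : ℕ} {p d w a κ : ℕ → ℕ} {s : State}
    (h : BestInv n p d w a κ N b x s)
    (h₀ : 0 < (TardyJobs.table p d w κ n 0).tag) : 0 < (TardyJobs.table p d w κ n b).tag := by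
  rcases h.tag with rfl | hw
  · exact h₀
  · by_contra htag
    rw [table_weight_eq_zero (by omega)] at hw
    omega

theorem wp_solve {n : ℕ} (I : Instance n) {f : ℕ} {g : Fin n → ℕ}
    (hg : f = 0 ∧ g = I.p ∨ f = 2 ∧ g = I.w) :
    WP (solve f) ((n + 1) * (n + 1) + ((n + 1) ^ #(univ.image g) + 1) * (n + 1))
      (fun s => ∃ π, s.Holds π ∧ I.IsOptimal π) I.initialState := by
  rw [← image_extend]
  set v₀ := extend g with hv₀
  set N := (n + 1) ^ #((range n).image v₀) with hN
  have hNpos : 0 < N := by positivity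
  have hc₁ : (n + 1) * (n + 1) ≤ (n + 1) * (n + 1) + (N + 1) * (n + 1) := Nat.le_add_right _ _
  have hc₂ : n + 1 ≤ (n + 1) * (n + 1) + (N + 1) * (n + 1) := by nlinarith
  have hc₃ : (N + 1) * (n + 1) ≤ (n + 1) * (n + 1) + (N + 1) * (n + 1) := Nat.le_add_left _ _
  have hc₄ : N + 1 ≤ (n + 1) * (n + 1) + (N + 1) * (n + 1) := by nlinarith
  -- Every phase fits into this one budget, so its exact form no longer matters.
  generalize (n + 1) * (n + 1) + (N + 1) * (n + 1) = c at *
  refine .seq (.exec rfl (by omega) (.seq (WP.mono (wp_sortJobs (n := n) (p := extend I.p)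
    (d := extend I.d) (w := extend I.w) ?_ (initialState_input I) (initialState_free I)) hc₁ ?_)))
  · constructor <;> simp [setup, Prog.exec, eval, Instance.initialState]
    omega
  intro s₁ hs₁
  obtain ⟨a, ha, hrec⟩ := hs₁.exists_records
  set p := fun r => extend I.p (a r) with hp
  set d := fun r => extend I.d (a r) with hd
  set w := fun r => extend I.w (a r) with hw
  have hv : ∀ r < n, s₁.mem (3 * n + 1 + 6 * r + f) = v₀ (a r) := by
    rcases hg with ⟨rfl, rfl⟩ | ⟨rfl, rfl⟩
    exacts [hrec.p, hrec.w]
  have hainv : ∀ j < n, a (rank (extend I.d) n j) = j := fun j hj =>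
    rank_injective (ha _ (rank_lt hj)).1 hj (ha _ (rank_lt hj)).2
  have himage : (range n).image (fun r => v₀ (a r)) = (range n).image v₀ := by
    ext x
    simp only [mem_image, mem_range]
    constructor
    · rintro ⟨r, hr, rfl⟩
      exact ⟨a r, (ha r hr).1, rfl⟩
    · rintro ⟨j, hj, rfl⟩
      exact ⟨rank (extend I.d) n j, rank_lt hj, by rw [hainv j hj]⟩
  refine .seq ((wp_assignKeys (by omega) hrec.header hv).mono hc₁ ?_)
  rintro s₂ ⟨e, hs₂⟩
  have hlt := hs₂.lt
  rw [himage] at hlt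
  set κ := fun q => (n + 1) ^ e q with hκ
  have hready : Ready n p d w a κ N s₂ :=
    ⟨hrec.congr hs₂.header fun r hr f hf => hs₂.frame _ fun q hq => by omega, hs₂.key, by
      rw [hs₂.reg6, himage]⟩
  have hdet : (∀ S ⊆ range n, ∀ T ⊆ range n, ∑ i ∈ S, κ i = ∑ i ∈ T, κ i →
        ∑ i ∈ S, p i = ∑ i ∈ T, p i) ∨
      (∀ S ⊆ range n, ∀ T ⊆ range n, ∑ i ∈ S, κ i = ∑ i ∈ T, κ i →
        ∑ i ∈ S, w i = ∑ i ∈ T, w i) := by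
    have h := fun S hS T hT => sum_eq_of_sum_pow_eq (S := S) (T := T) hlt
      (fun r hr q hq => hs₂.eq r hr q hq) hS hT
    rcases hg with ⟨-, rfl⟩ | ⟨-, rfl⟩
    exacts [.inl h, .inr h]
  refine .seq ((wp_fillTable hNpos hready
    (fun q hq => (hs₂.frame _ fun r hr => by omega).trans (hs₁.flag q hq))
    (fun b hb => (hs₂.frame _ fun r hr => by omega).trans (hs₁.free b hb))).mono hc₃ ?_)
  intro s₃ hs₃
  refine .seq ((wp_findBest hNpos hs₃).mono hc₄ ?_)
  rintro s₄ ⟨b, hs₄⟩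
  refine .seq ((wp_backtrack hs₄).mono hc₂ ?_)
  rintro s₅ ⟨x, hs₅⟩
  -- The empty set is feasible with key sum `0`, so column `0` records a set.
  have htag := hs₄.tag_pos (by
    simpa using (table_complete (p := p) (d := d) (w := w) hdet le_rfl (empty_subset _)
      (by simp [Feasible])).1)
  obtain ⟨hfeas, -, -, hweight⟩ := table_sound htag
  set T := trace p d w κ n b
  refine (wp_output hs₅.filled.ready.records (T := T) (by simpa using hs₅.flag)).mono hc₂ ?_
  intro s₆ hs₆
  let ρ : Equiv.Perm (Fin n) := permOfInjOn (rank (extend I.d) n) (fun _ => rank_lt)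
    (fun _ hi _ hj => rank_injective hi hj)
  let θ : Equiv.Perm (Fin n) := permOfInjOn (position T n) (fun _ => position_lt)
    (fun _ hi _ hj => position_injective hi hj)
  have haρ : ∀ j, a (ρ j) = j := fun j => hainv j j.2
  refine ⟨ρ.trans θ, fun i => ?_, isOptimal_of_feasible (p := p) (d := d) (w := w) (ρ := ρ)
    (T := T) (fun j => by simp [hp, haρ]) (fun j => by simp [hd, haρ])
    (fun j => by simp [hw, haρ]) (fun r hr q hq => ?_) (trace_subset _ _) hfeas
    (fun S hS hSf => ?_) fun j => rfl⟩
  · obtain ⟨j, rfl⟩ := (ρ.trans θ).surjective i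
    rw [Equiv.symm_apply_apply]
    exact (hs₆ _ (ρ j).2).trans (haρ j)
  · refine le_of_rank_le (d := extend I.d) (i := a q) (ha r hr).1 ?_
    rw [(ha r hr).2, (ha q (by omega)).2]
    exact hq
  · rw [hweight]
    -- The entry in the column of `S` dominates `S`, and that column is among the `N` columns that
    -- were searched.
    exact (table_complete hdet le_rfl hS hSf).2.2.trans (hs₄.best _ (sum_pow_lt hlt hS))

/-! ### The running time -/

/-- `(1 + 1 / n) ^ (m + 1) ≤ exp ((m + 1) / n) ≤ exp 2 < 8`, because `m + 1 ≤ 2 * n`. -/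
theorem succ_pow_le {n m : ℕ} (hn : 2 ≤ n) (hm : m ≤ n) :
    (n + 1) ^ (m + 1) ≤ 8 * n ^ (m + 1) := by
  have hn' : (0 : ℝ) < n := by positivity
  have h : ((1 : ℝ) + 1 / n) ^ (m + 1) ≤ 8 := by
    calc ((1 : ℝ) + 1 / n) ^ (m + 1) ≤ Real.exp (1 / n) ^ (m + 1) := by
          gcongr
          rw [add_comm]
          exact Real.add_one_le_exp _
      _ = Real.exp ((m + 1 : ℕ) * (1 / n)) := (Real.exp_nat_mul _ _).symm
      _ ≤ Real.exp (2 : ℕ) := by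
          rw [Real.exp_le_exp, mul_one_div, div_le_iff₀ hn']
          exact_mod_cast (by omega : m + 1 ≤ 2 * n)
      _ = Real.exp 1 ^ 2 := by rw [Real.exp_one_pow]
      _ ≤ 8 := by nlinarith [Real.exp_one_lt_d9, Real.exp_pos 1]
  have h' : ((n : ℝ) + 1) ^ (m + 1) ≤ 8 * (n : ℝ) ^ (m + 1) := by
    calc ((n : ℝ) + 1) ^ (m + 1) = (1 + 1 / n) ^ (m + 1) * (n : ℝ) ^ (m + 1) := by
          rw [← mul_pow]
          congr 1
          field_simp
      _ ≤ 8 * (n : ℝ) ^ (m + 1) := by gcongr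
  exact_mod_cast h'

/-- For `n ≥ 2` the left side consists of three terms, each at most `(n + 1) ^ (m + 1)` with `m` the
number of values, and `24 = 3 * 8`. The quadratic term needs `m ≥ 1`. The cases `n = 0` and `n = 1`
are checked by hand. -/
theorem iterations_le {n : ℕ} (g : Fin n → ℕ) :
    (n + 1) * (n + 1) + ((n + 1) ^ #(univ.image g) + 1) * (n + 1) ≤
      24 * (n ^ (#(univ.image g) + 1) * Nat.log 2 n + 1) := by
  have hm : #(univ.image g) ≤ n := card_image_le.trans (by simp)
  have hm' : 0 < n → 1 ≤ #(univ.image g) := fun hn =>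
    card_pos.2 ⟨g ⟨0, hn⟩, mem_image_of_mem _ (mem_univ _)⟩
  generalize #(univ.image g) = m at *
  rcases Nat.lt_or_ge n 2 with hn | hn
  · interval_cases n
    · obtain rfl : m = 0 := by omega
      norm_num
    · obtain rfl : m = 1 := by have := hm' one_pos; omega
      norm_num
  · have h₁ : (n + 1) * (n + 1) ≤ (n + 1) ^ (m + 1) := by
      rw [← sq]
      exact Nat.pow_le_pow_right (by omega) (by have := hm' (by omega); omega)
    have h₂ : n + 1 ≤ (n + 1) ^ (m + 1) := Nat.le_self_pow (by omega) _
    have h₃ := succ_pow_le hn hm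
    have h₄ : n ^ (m + 1) ≤ n ^ (m + 1) * Nat.log 2 n :=
      Nat.le_mul_of_pos_right _ (Nat.log_pos (by omega) hn)
    have h₅ : ((n + 1) ^ m + 1) * (n + 1) = (n + 1) ^ (m + 1) + (n + 1) := by
      rw [Nat.add_mul, ← pow_succ, Nat.one_mul]
    omega

theorem exists_runs_solve {n : ℕ} (I : Instance n) {f : ℕ} {g : Fin n → ℕ}
    (hg : f = 0 ∧ g = I.p ∨ f = 2 ∧ g = I.w) :
    ∃ t s, Runs unitCost (solve f) I.initialState t s ∧
      t ≤ (solve f).size * 24 * (n ^ (#(univ.image g) + 1) * Nat.log 2 n + 1) ∧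
      ∃ π, s.Holds π ∧ I.IsOptimal π := by
  rw [Nat.mul_assoc]
  exact (wp_solve I hg).mono (iterations_le g) fun _ h => h

theorem solve_solves {f : ℕ} (hf : f = 0 ∨ f = 2) : (solve f).Solves := by
  intro n I
  have : ∃ g, f = 0 ∧ g = I.p ∨ f = 2 ∧ g = I.w := by
    rcases hf with hf | hf
    exacts [⟨_, .inl ⟨hf, rfl⟩⟩, ⟨_, .inr ⟨hf, rfl⟩⟩]
  obtain ⟨g, hg⟩ := this
  obtain ⟨t, s, hr, -, π, hπ⟩ := exists_runs_solve I hg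
  exact ⟨t, s, π, hr, hπ⟩

theorem solve_runsInTime_numWeights : (solve 2).RunsInTime Instance.numWeights :=
  ⟨(solve 2).size * 24, fun _ I =>
    let ⟨t, s, hr, ht, _⟩ := exists_runs_solve I (.inr ⟨rfl, rfl⟩)
    ⟨t, s, hr, ht⟩⟩

theorem solve_runsInTime_numProcTimes : (solve 0).RunsInTime Instance.numProcTimes :=
  ⟨(solve 0).size * 24, fun _ I =>
    let ⟨t, s, hr, ht, _⟩ := exists_runs_solve I (.inl ⟨rfl, rfl⟩)
    ⟨t, s, hr, ht⟩⟩

end TardyJobs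

theorem theorem3 :
    (∃ P : TardyJobs.Prog, P.Solves ∧
      P.RunsInTime TardyJobs.Instance.numWeights ∧
      P.PolyTimeForConstant TardyJobs.Instance.numWeights) ∧
    (∃ P : TardyJobs.Prog, P.Solves ∧
      P.RunsInTime TardyJobs.Instance.numProcTimes ∧
      P.PolyTimeForConstant TardyJobs.Instance.numProcTimes) :=
  ⟨⟨TardyJobs.solve 2, TardyJobs.solve_solves (.inr rfl), TardyJobs.solve_runsInTime_numWeights,
      TardyJobs.solve_runsInTime_numWeights.polyTimeForConstant⟩,
    ⟨TardyJobs.solve 0, TardyJobs.solve_solves (.inl rfl),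
      TardyJobs.solve_runsInTime_numProcTimes,
      TardyJobs.solve_runsInTime_numProcTimes.polyTimeForConstant⟩⟩
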